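/- **Theorem (generalised Moser inequality for mixed states).** Let $(X,\mu)$ be a $\sigma$-finite measure space, $H$ a complex Hilbert space and $\mathcal H=L^2(X,\mu;H)$. Let $A$ be a positive self-adjoint (possibly unbounded) operator on $\mathcal H$ with spectral projections $\chi_A(S)$, and let $\rho\neq 0$ be a positive bounded operator on $\mathcal H$ with operator norm $\|\rho\|$. For a positive bounded operator $P$ on $\mathcal H$ let $\nu_P$ be the measure $\nu_P(\Omega)=\tau(\chi_\Omega P\chi_\Omega)=\tau(P^{1/2}\chi_\Omega P^{1/2})\in[0,\infty]$ on $X$, where $\tau$ is the trace and $\chi_\Omega$ is multiplication by the indicator function of the measurable set $\Omega$; let $D\nu_P=\frac{d\nu_P}{d\mu}\colon X\to[0,\infty]$ be its density. Let $\mathcal E(\rho)=\tau(\rho^{1/2}A\rho^{1/2})=\sum_i\|A^{1/2}\rho^{1/2}e_i\|^2\in[0,\infty]$ for a Hilbert basis $(e_i)$ of $\mathcal H$, where $\|A^{1/2}v\|^2=\infty$ if $v$ is not in the domain of $A^{1/2}$. Suppose that either * $\rho=0$ on $\ker A$, and $F_x(\lambda)=D\nu_{\Pi_\lambda}(x)$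 with $\Pi_\lambda=\chi_A(\,]0,\lambda])$ for all $\lambda\ge 0$; or * $\rho$ is arbitrary, and $F_x(\lambda)=D\nu_{\Pi_\lambda}(x)$ with $\Pi_\lambda=\chi_A([0,\lambda])$ for all $\lambda\ge 0$. Here, densities being defined only $\mu$-almost everywhere, $(F_x(\lambda))$ is any choice of versions such that for $\mu$-almost every $x$ the function $\lambda\mapsto F_x(\lambda)\in[0,\infty]$ is nondecreasing. For $u\in[0,\infty]$ put $$F_x^{-1}(u)=\sup\{\lambda\ge 0 : F_x(\lambda)<\infty \text{ and } F_x(\lambda)\le u\}\in[0,\infty],\qquad \sup\emptyset=0.$$ Then $$\int_X F_x^{-1}\Bigl(\frac{D\nu_\rho(x)}{4\|\rho\|}\Bigr)\,d\nu_\rho(x)\le 4\,\mathcal E(\rho).$$ -/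

import Mathlib

open MeasureTheory Set
open scoped ENNReal NNReal InnerProductSpace

noncomputable section

namespace MixedState

section Hilbert

variable {E : Type*} [NormedAddCommGroup E] [InnerProductSpace ℂ E] [CompleteSpace E]

/-- A projection-valued measure on the Borel sets of `ℝ`, with values in the orthogonal projections
of `E`. The values on non-measurable sets are irrelevant. -/
structure ProjectionValuedMeasure (E : Type*) [NormedAddCommGroup E] [InnerProductSpace ℂ E]
    [CompleteSpace E] where
  /-- The projection attached to a set. -/
  proj : Set ℝ → (E →L[ℂ] E)
  isStarProjection : ∀ S, MeasurableSet S → IsStarProjection (proj S)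
  univ : proj univ = 1
  inter : ∀ S T, MeasurableSet S → MeasurableSet T → proj (S ∩ T) = proj S ∘L proj T
  iUnion : ∀ S : ℕ → Set ℝ, (∀ n, MeasurableSet (S n)) → Pairwise (fun m n => Disjoint (S m) (S n)) →
    ∀ v : E, HasSum (fun n => proj (S n) v) (proj (⋃ n, S n) v)

/-- The projection-valued Dirac measure at `0`, only used to know that the type is inhabited. -/
instance : Nonempty (ProjectionValuedMeasure E) := by
  classical
  refine ⟨{ proj := fun S => if (0 : ℝ) ∈ S then 1 else 0
            isStarProjection := ?_, univ := by simp, inter := ?_, iUnion := ?_ }⟩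
  · intro S _
    split_ifs
    · exact IsStarProjection.one _
    · exact IsStarProjection.zero _
  · intro S T _ _
    by_cases hS : (0 : ℝ) ∈ S <;> by_cases hT : (0 : ℝ) ∈ T <;> simp [hS, hT, ContinuousLinearMap.one_def]
  · intro S _ hd v
    by_cases h : ∃ n, (0 : ℝ) ∈ S n
    · obtain ⟨n, hn⟩ := h
      have h1 : (0 : ℝ) ∈ ⋃ n, S n := mem_iUnion.2 ⟨n, hn⟩
      have h2 : ∀ m, m ≠ n → (0 : ℝ) ∉ S m := fun m hm h0 =>
        Set.disjoint_left.1 (hd hm) h0 hn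
      rw [if_pos h1]
      have := hasSum_single (f := fun m => (if (0 : ℝ) ∈ S m then (1 : E →L[ℂ] E) else 0) v) n
        (fun m hm => by simp [h2 m hm])
      simpa [hn] using this
    · have h1 : (0 : ℝ) ∉ ⋃ n, S n := by simpa using h
      have h2 : ∀ n, (0 : ℝ) ∉ S n := by simpa using h
      simp only [if_neg h1, h2, if_false]
      simp

/-- The scalar spectral measure `S ↦ ⟨v, P(S) v⟩ = ‖P(S) v‖²` of a vector `v`. -/
def ProjectionValuedMeasure.scalar (P : ProjectionValuedMeasure E) (v : E) : Measure ℝ :=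
  Measure.ofMeasurable (fun S _ => ENNReal.ofReal (⟪v, P.proj S v⟫_ℂ).re)
    (by
      have h := P.iUnion (fun _ => ∅) (fun _ => MeasurableSet.empty) (fun _ _ _ => by simp) v
      have h0 : P.proj ∅ v = 0 := by
        exact (summable_const_iff _).1 h.summable
      simp [h0])
    (by
      intro S hS hd
      have h := P.iUnion S hS hd v
      have h1 : HasSum (fun n => (⟪v, P.proj (S n) v⟫_ℂ).re) (⟪v, P.proj (⋃ n, S n) v⟫_ℂ).re :=
        Complex.hasSum_re (h.mapL (innerSL ℂ v))
      rw [← h1.tsum_eq]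
      refine ENNReal.ofReal_tsum_of_nonneg (fun n => ?_) h1.summable
      have hp := (ContinuousLinearMap.IsPositive.of_isStarProjection
        (P.isStarProjection (S n) (hS n)))
      exact hp.re_inner_nonneg_right v)

/-- `P` is the spectral measure of the (unbounded) operator `A`, that is `A = ∫ t dP(t)`: the domain
of `A` consists of the `v` with `∫ t² d⟨v, P(t) v⟩ < ∞`, and `⟨v, A v⟩ = ∫ t d⟨v, P(t) v⟩` there. -/
def IsSpectralMeasure (A : E →ₗ.[ℂ] E) (P : ProjectionValuedMeasure E) : Prop :=
  (∀ v : E, v ∈ A.domain ↔ ∫⁻ t, ENNReal.ofReal (t ^ 2) ∂(P.scalar v) < ∞) ∧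
    ∀ v : A.domain, ⟪(v : E), A v⟫_ℂ = ((∫ t, t ∂(P.scalar (v : E)) : ℝ) : ℂ)

/-- The spectral measure of `A`. By the spectral theorem it exists, and is unique on Borel sets,
when `A` is self-adjoint; the value for other `A` is irrelevant. -/
def spectralMeasure (A : E →ₗ.[ℂ] E) : ProjectionValuedMeasure E :=
  Classical.epsilon (IsSpectralMeasure A)

/-- The spectral projection `χ_A(S)` of a self-adjoint operator `A`. -/
def spectralProjection (A : E →ₗ.[ℂ] E) (S : Set ℝ) : E →L[ℂ] E :=
  (spectralMeasure A).proj S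

/-- The closed quadratic form of a positive self-adjoint operator `A`: it is
`‖A^{1/2} v‖² = ∫ t d⟨v, χ_A(t) v⟩` on the domain of `A^{1/2}`, and `∞` elsewhere. -/
def quadraticForm (A : E →ₗ.[ℂ] E) (v : E) : ℝ≥0∞ :=
  ∫⁻ t, ENNReal.ofReal t ∂((spectralMeasure A).scalar v)

/-- The trace `∑ᵢ q(eᵢ)` of a nonnegative quadratic form `q` over a Hilbert basis `(eᵢ)`; for the
closed forms used here it does not depend on the basis. -/
def formTrace (q : E → ℝ≥0∞) : ℝ≥0∞ :=
  ∑' i : (exists_hilbertBasis ℂ E).choose, q (i : E)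

/-- The trace of a positive bounded operator, a value in `[0, ∞]`. -/
def trace (T : E →L[ℂ] E) : ℝ≥0∞ :=
  formTrace fun v => ENNReal.ofReal (⟪v, T v⟫_ℂ).re

/-- The positive square root of a positive bounded operator. -/
def opSqrt (T : E →L[ℂ] E) : E →L[ℂ] E := CFC.sqrt T

theorem inner_opSqrt_right (T : E →L[ℂ] E) (v w : E) : ⟪v, opSqrt T w⟫_ℂ = ⟪opSqrt T v, w⟫_ℂ := by
  have hs : IsSelfAdjoint (opSqrt T) := (CFC.sqrt_nonneg T).isSelfAdjoint
  rw [← ContinuousLinearMap.adjoint_inner_left, hs.adjoint_eq]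

/-- The energy `τ(ρ^{1/2} A ρ^{1/2})` of a positive bounded `ρ` for a positive self-adjoint `A`:
the trace of the form `v ↦ ‖A^{1/2} ρ^{1/2} v‖²`. -/
def energy (A : E →ₗ.[ℂ] E) (ρ : E →L[ℂ] E) : ℝ≥0∞ :=
  formTrace fun v => quadraticForm A (opSqrt ρ v)

end Hilbert

section Density

variable {X : Type*} [MeasurableSpace X] (μ : Measure X)
  {H : Type*} [NormedAddCommGroup H] [InnerProductSpace ℂ H]

/-- Multiplication by the indicator function of `Ω` on `L²(X, H)`. -/
def cutoff (Ω : Set X) (hΩ : MeasurableSet Ω) : Lp H 2 μ →L[ℂ] Lp H 2 μ :=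
  LinearMap.mkContinuous
    { toFun := fun f => ((Lp.memLp f).indicator hΩ).toLp (Ω.indicator f)
      map_add' := by
        intro f g
        rw [← MemLp.toLp_add]
        refine MemLp.toLp_congr _ _ ?_
        filter_upwards [Lp.coeFn_add f g] with x hx
        by_cases h : x ∈ Ω
        · simpa [h] using hx
        · simp [h]
      map_smul' := by
        intro c f
        rw [RingHom.id_apply, ← MemLp.toLp_const_smul]
        refine MemLp.toLp_congr _ _ ?_
        filter_upwards [Lp.coeFn_smul c f] with x hx
        by_cases h : x ∈ Ω
        · simpa [h] using hx
        · simp [h] }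
    1
    (by
      intro f
      rw [one_mul]
      refine Lp.norm_le_norm_of_ae_le ?_
      filter_upwards [((Lp.memLp f).indicator hΩ).coeFn_toLp] with x hx
      simp only [LinearMap.coe_mk, AddHom.coe_mk]
      rw [hx]
      exact norm_indicator_le_norm_self _ _)

theorem coeFn_cutoff (Ω : Set X) (hΩ : MeasurableSet Ω) (f : Lp H 2 μ) :
    cutoff μ Ω hΩ f =ᵐ[μ] Ω.indicator f :=
  ((Lp.memLp f).indicator hΩ).coeFn_toLp

theorem ofReal_inner_cutoff (Ω : Set X) (hΩ : MeasurableSet Ω) (f : Lp H 2 μ) :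
    ENNReal.ofReal (⟪f, cutoff μ Ω hΩ f⟫_ℂ).re = ∫⁻ x in Ω, ‖f x‖ₑ ^ 2 ∂μ := by
  have hm : MemLp (Ω.indicator f) 2 μ := (Lp.memLp f).indicator hΩ
  have hint := (memLp_two_iff_integrable_sq_norm hm.1).1 hm
  have h1 : ⟪f, cutoff μ Ω hΩ f⟫_ℂ = ((∫ x, ‖Ω.indicator f x‖ ^ 2 ∂μ : ℝ) : ℂ) := by
    rw [L2.inner_def, ← integral_complex_ofReal]
    refine integral_congr_ae ?_
    filter_upwards [coeFn_cutoff μ Ω hΩ f] with x hx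
    rw [hx]
    by_cases h : x ∈ Ω
    · simp [h, inner_self_eq_norm_sq_to_K]
    · simp [h]
  rw [h1, Complex.ofReal_re,
    ofReal_integral_eq_lintegral_ofReal hint (Filter.Eventually.of_forall fun x => by positivity),
    ← lintegral_indicator hΩ]
  refine lintegral_congr fun x => ?_
  by_cases h : x ∈ Ω
  · simp only [h, indicator_of_mem]
    rw [ENNReal.ofReal_pow (norm_nonneg _), ofReal_norm]
  · simp [h]

variable [CompleteSpace H]

theorem trace_sqrt_cutoff_sqrt (P : Lp H 2 μ →L[ℂ] Lp H 2 μ) (Ω : Set X) (hΩ : MeasurableSet Ω) :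
    trace (opSqrt P ∘L cutoff μ Ω hΩ ∘L opSqrt P) =
      formTrace fun v : Lp H 2 μ => ∫⁻ x in Ω, ‖opSqrt P v x‖ₑ ^ 2 ∂μ := by
  unfold trace
  congr 1
  funext v
  rw [← ofReal_inner_cutoff μ Ω hΩ]
  simp only [ContinuousLinearMap.comp_apply, inner_opSqrt_right]

/-- The measure `ν_P(Ω) = τ(P^{1/2} χ_Ω P^{1/2})` of a positive bounded operator `P`
on `L²(X, H)`. -/
def traceMeasure (P : Lp H 2 μ →L[ℂ] Lp H 2 μ) : Measure X :=
  Measure.ofMeasurable (fun Ω hΩ => trace (opSqrt P ∘L cutoff μ Ω hΩ ∘L opSqrt P))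
    (by rw [trace_sqrt_cutoff_sqrt]; simp [formTrace])
    (by
      intro S hS hd
      simp only [trace_sqrt_cutoff_sqrt, formTrace]
      rw [ENNReal.tsum_comm]
      exact tsum_congr fun i => lintegral_iUnion hS hd _)

/-- The density function `D ν_P = dν_P / dμ` of a positive bounded operator `P`. -/
def density (P : Lp H 2 μ →L[ℂ] Lp H 2 μ) : X → ℝ≥0∞ :=
  (traceMeasure μ P).rnDeriv μ

/-- `F x t` is the pointwise density at `x` of the increasing family `Q t` of projections. Each
density `D ν_{Q t}` is only defined up to a null set, hence one takes versions of these functions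
that are, for almost every `x`, nondecreasing in `t`. -/
def IsPointwiseDensity (Q : ℝ≥0 → (Lp H 2 μ →L[ℂ] Lp H 2 μ)) (F : X → ℝ≥0 → ℝ≥0∞) : Prop :=
  (∀ᵐ x ∂μ, Monotone (F x)) ∧ ∀ t : ℝ≥0, (fun x => F x t) =ᵐ[μ] density μ (Q t)

end Density

/-- The generalised inverse `u ↦ sup {t ≥ 0 | F t ≤ u}` of a nondecreasing `F`, with value `0` when
the set is empty. Only finite values of `F` count, which matters for `u = ∞` alone. -/
def genInverse (F : ℝ≥0 → ℝ≥0∞) (u : ℝ≥0∞) : ℝ≥0∞ :=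
  ⨆ (t : ℝ≥0) (_ : F t < ∞ ∧ F t ≤ u), (t : ℝ≥0∞)

end MixedState

end

noncomputable section

open Filter Topology

namespace MixedState

/-! ### Approximation by continuous functions in L² of a finite measure -/

section LpApproximation

variable {K : Type*} [MeasurableSpace K]

/-! Put L = ρ^{1/2} and Q = Π_t. On the range of L the operator 1 - Q acts as χ_A(]t, ∞[); when Q =
χ_A(]0, t]) this holds because ρ kills ker A. From L = QL + (1 - Q)L and |a + b|² ≤ 2|a|² + 2|b|²
one gets Dν_ρ ≤ 2‖ρ‖ Dν_Q + 2D almost everywhere, where D is the density of Ω ↦ ‖χ_Ω (1 - Q) L‖² in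
Hilbert-Schmidt norm (`ae_density_le`). On the set G_t where Dν_Q is finite and at most Dν_ρ /
(4‖ρ‖), the first term is at most Dν_ρ / 2 and is absorbed, so ν_ρ(G_t) ≤ 4‖χ_A(]t, ∞[) L‖²
(`traceMeasure_le_of_density_le`). Integrated in t, the left side gives the integral of F_x^{-1}, as
{t : x ∈ G_t} is an initial interval, and the right side gives 4 E(ρ) by the layer cake formula.

The versions F_x(t) are tied to the densities only for each t separately, so only countably many t
may be used: the integral in t becomes a Riemann sum, and Fatou's lemma passes to the limit
(`lintegral_genInverse_le`).

Since the spectral measure of A is picked by a choice operator, its existence has to be proved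
(`exists_isSpectralMeasure`). The continuous functional calculus of the resolvent R = (1 + A)⁻¹ is
extended to Borel functions through the measures m_v representing f ↦ ⟨v, f(R) v⟩, and the
projections obtained are transported by x ↦ 1/x - 1. -/

theorem tendsto_eLpNorm_mono {m m' : Measure K} (hm : m ≤ m') {f : ℕ → K → ℝ}
    (hf : Tendsto (fun n => eLpNorm (f n) 2 m') atTop (𝓝 0)) :
    Tendsto (fun n => eLpNorm (f n) 2 m) atTop (𝓝 0) :=
  tendsto_of_tendsto_of_tendsto_of_le_of_le tendsto_const_nhds hf (fun _ => zero_le)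
    fun _ => eLpNorm_mono_measure _ hm

theorem tendsto_eLpNorm_mul {m : Measure K} {g : K → ℝ} {C : ℝ}
    (hC : ∀ x, ‖g x‖ ≤ C) {f : ℕ → K → ℝ}
    (hf : Tendsto (fun n => eLpNorm (f n) 2 m) atTop (𝓝 0)) :
    Tendsto (fun n => eLpNorm (g * f n) 2 m) atTop (𝓝 0) := by
  have h : Tendsto (fun n => ENNReal.ofReal C * eLpNorm (f n) 2 m) atTop (𝓝 0) := by
    simpa using ENNReal.Tendsto.const_mul hf (Or.inr ENNReal.ofReal_ne_top)
  refine tendsto_of_tendsto_of_tendsto_of_le_of_le tendsto_const_nhds h (fun _ => zero_le)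
    fun n => eLpNorm_le_mul_eLpNorm_of_ae_le_mul (Eventually.of_forall fun x => ?_) _
  rw [Pi.mul_apply, norm_mul]
  exact mul_le_mul_of_nonneg_right (hC x) (norm_nonneg _)

variable [MetricSpace K] [CompactSpace K] [BorelSpace K]

theorem memLp_continuousMap (m : Measure K) [IsFiniteMeasure m] (f : C(K, ℝ)) (p : ℝ≥0∞) :
    MemLp f p m :=
  MemLp.of_bound f.continuous.aestronglyMeasurable ‖f‖ (Eventually.of_forall f.norm_coe_le_norm)

theorem exists_tendsto_eLpNorm (m : Measure K) [IsFiniteMeasure m] {g : K → ℝ}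
    (hg : MemLp g 2 m) :
    ∃ f : ℕ → C(K, ℝ), Tendsto (fun n => eLpNorm (⇑(f n) - g) 2 m) atTop (𝓝 0) := by
  have h := fun n : ℕ => hg.exists_boundedContinuous_eLpNorm_sub_le (by simp)
    (ε := ((n : ℝ≥0∞) + 1)⁻¹) (by simp)
  choose f hf _ using h
  refine ⟨fun n => (f n).toContinuousMap, ?_⟩
  refine tendsto_of_tendsto_of_tendsto_of_le_of_le tendsto_const_nhds (h := fun n : ℕ => ((n : ℝ≥0∞) + 1)⁻¹)
    ?_ (fun _ => zero_le) fun n => ?_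
  · have := (tendsto_add_atTop_iff_nat 1).2 ENNReal.tendsto_inv_nat_nhds_zero
    simpa using this
  · rw [eLpNorm_sub_comm]
    exact hf n

end LpApproximation

/-! ### From a continuous functional calculus to Borel functions -/

section ContinuousCalculus

variable {E : Type*} [NormedAddCommGroup E] [InnerProductSpace ℂ E] [CompleteSpace E]
  {K : Type*} [MetricSpace K]
  (Φ : C(K, ℝ) →⋆ₐ[ℝ] (E →L[ℂ] E))

theorem isSelfAdjoint_starAlgHom (f : C(K, ℝ)) : IsSelfAdjoint (Φ f) := by
  rw [IsSelfAdjoint, ← map_star]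
  congr 1

theorem inner_starAlgHom_left (f : C(K, ℝ)) (v w : E) : ⟪Φ f v, w⟫_ℂ = ⟪v, Φ f w⟫_ℂ := by
  rw [← ContinuousLinearMap.adjoint_inner_left, (isSelfAdjoint_starAlgHom Φ f).adjoint_eq]

theorem starAlgHom_mul_apply (f g : C(K, ℝ)) (v : E) : Φ (f * g) v = Φ f (Φ g v) := by
  rw [map_mul]; rfl

theorem norm_sq_starAlgHom_apply (f : C(K, ℝ)) (v : E) :
    ‖Φ f v‖ ^ 2 = (⟪v, Φ (f * f) v⟫_ℂ).re := by
  rw [starAlgHom_mul_apply, ← inner_starAlgHom_left, inner_self_eq_norm_sq_to_K]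
  norm_cast

/-- Since f = (√f)², the number is ‖Φ(√f) v‖². This positivity is what the Riesz-Markov theorem
needs. -/
theorem re_inner_starAlgHom_nonneg {f : C(K, ℝ)} (hf : 0 ≤ f) (v : E) :
    0 ≤ (⟪v, Φ f v⟫_ℂ).re := by
  have : f = (⟨fun x => √(f x), by fun_prop⟩ : C(K, ℝ)) * ⟨fun x => √(f x), by fun_prop⟩ := by
    ext x
    exact (Real.mul_self_sqrt (hf x)).symm
  rw [this, ← norm_sq_starAlgHom_apply]
  positivity

variable [CompactSpace K] [MeasurableSpace K] [BorelSpace K]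

theorem exists_measure_integral_eq_inner (v : E) :
    ∃ m : Measure K, IsFiniteMeasure m ∧ ∀ f : C(K, ℝ), ∫ x, f x ∂m = (⟪v, Φ f v⟫_ℂ).re := by
  let Λ : CompactlySupportedContinuousMap K ℝ →ₗ[ℝ] ℝ :=
    { toFun := fun f => (⟪v, Φ f.toContinuousMap v⟫_ℂ).re
      map_add' := fun f g => by
        have : (f + g).toContinuousMap = f.toContinuousMap + g.toContinuousMap := rfl
        rw [this, map_add, add_apply, inner_add_right, Complex.add_re]
      map_smul' := fun c f => by
        have : (c • f).toContinuousMap = c • f.toContinuousMap := rfl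
        rw [this, map_smul, smul_apply, inner_smul_right_eq_smul,
          Complex.smul_re, RingHom.id_apply] }
  let Λ' : CompactlySupportedContinuousMap K ℝ →ₚ[ℝ] ℝ := PositiveLinearMap.mk₀ Λ
    fun f hf => re_inner_starAlgHom_nonneg Φ (f := f.toContinuousMap) hf v
  refine ⟨RealRMK.rieszMeasure Λ', inferInstance, fun f => ?_⟩
  exact RealRMK.integral_rieszMeasure Λ' (CompactlySupportedContinuousMap.continuousMapEquiv f)

/-- The measure `m_v` representing the functional `f ↦ ⟨v, Φ f v⟩`. -/
def repMeasure (v : E) : Measure K := (exists_measure_integral_eq_inner Φ v).choose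

instance (v : E) : IsFiniteMeasure (repMeasure Φ v) :=
  (exists_measure_integral_eq_inner Φ v).choose_spec.1

theorem integral_repMeasure (v : E) (f : C(K, ℝ)) :
    ∫ x, f x ∂(repMeasure Φ v) = (⟪v, Φ f v⟫_ℂ).re :=
  (exists_measure_integral_eq_inner Φ v).choose_spec.2 f

/-- Both squares equal ∫ f² dm_v, so f ↦ Φ f v extends isometrically to all of L²(m_v). -/
theorem norm_starAlgHom_apply (f : C(K, ℝ)) (v : E) :
    ‖Φ f v‖ = ‖ContinuousMap.toLp 2 (repMeasure Φ v) ℝ f‖ := by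
  rw [← sq_eq_sq₀ (norm_nonneg _) (norm_nonneg _), norm_sq_starAlgHom_apply,
    ← integral_repMeasure, ← real_inner_self_eq_norm_sq, ContinuousMap.inner_toLp]
  simp

/-- The linear map `f ↦ Φ f v`. -/
def orbitMap (v : E) : C(K, ℝ) →ₗ[ℝ] E where
  toFun f := Φ f v
  map_add' f g := by rw [map_add]; rfl
  map_smul' c f := by rw [map_smul]; rfl

theorem norm_orbitMap (v : E) (f : C(K, ℝ)) :
    ‖orbitMap Φ v f‖ ≤ 1 * ‖(ContinuousMap.toLp 2 (repMeasure Φ v) ℝ).toLinearMap f‖ := by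
  rw [one_mul]
  exact (norm_starAlgHom_apply Φ f v).le

/-- The isometry `L²(m_v) → E` extending `f ↦ Φ f v`. -/
def cyclicMap (v : E) : Lp ℝ 2 (repMeasure Φ v) →L[ℝ] E :=
  (orbitMap Φ v).extendOfNorm (ContinuousMap.toLp 2 (repMeasure Φ v) ℝ).toLinearMap

theorem cyclicMap_toLp (v : E) (f : C(K, ℝ)) :
    cyclicMap Φ v (ContinuousMap.toLp 2 (repMeasure Φ v) ℝ f) = Φ f v := by
  have h := LinearMap.extendOfNorm_eq (f := orbitMap Φ v)
    (e := (ContinuousMap.toLp 2 (repMeasure Φ v) ℝ).toLinearMap)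
    (ContinuousMap.toLp_denseRange ℝ (repMeasure Φ v) ℝ (p := 2) (by simp))
    ⟨1, norm_orbitMap Φ v⟩ f
  exact h

theorem norm_cyclicMap (v : E) (g : Lp ℝ 2 (repMeasure Φ v)) : ‖cyclicMap Φ v g‖ = ‖g‖ := by
  refine (ContinuousMap.toLp_denseRange ℝ (repMeasure Φ v) ℝ (p := 2) (by simp)).induction_on
    (p := fun g => ‖cyclicMap Φ v g‖ = ‖g‖) g (isClosed_eq (by fun_prop) (by fun_prop)) fun f => ?_
  rw [cyclicMap_toLp, norm_starAlgHom_apply]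

open Classical in
/-- The vector `g(Φ) v` for `g` in `L²(m_v)`. -/
def applyFun (v : E) (g : K → ℝ) : E :=
  if hg : MemLp g 2 (repMeasure Φ v) then cyclicMap Φ v (hg.toLp g) else 0

variable {Φ}

theorem applyFun_eq {v : E} {g : K → ℝ} (hg : MemLp g 2 (repMeasure Φ v)) :
    applyFun Φ v g = cyclicMap Φ v (hg.toLp g) := by
  rw [applyFun, dif_pos hg]

theorem applyFun_congr {v : E} {g h : K → ℝ} (hg : MemLp g 2 (repMeasure Φ v))
    (hgh : g =ᵐ[repMeasure Φ v] h) : applyFun Φ v g = applyFun Φ v h := by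
  rw [applyFun_eq hg, applyFun_eq ((memLp_congr_ae hgh).1 hg)]
  congr 1
  exact MemLp.toLp_congr _ _ hgh

variable (Φ) in
theorem applyFun_continuousMap (v : E) (f : C(K, ℝ)) : applyFun Φ v f = Φ f v := by
  rw [applyFun_eq (memLp_continuousMap _ f 2), ← cyclicMap_toLp]
  congr 1

theorem applyFun_add {v : E} {g h : K → ℝ} (hg : MemLp g 2 (repMeasure Φ v))
    (hh : MemLp h 2 (repMeasure Φ v)) :
    applyFun Φ v (g + h) = applyFun Φ v g + applyFun Φ v h := by
  rw [applyFun_eq hg, applyFun_eq hh, applyFun_eq (hg.add hh), MemLp.toLp_add, map_add]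

theorem norm_sq_applyFun {v : E} {g : K → ℝ} (hg : MemLp g 2 (repMeasure Φ v)) :
    ‖applyFun Φ v g‖ ^ 2 = ∫ x, g x ^ 2 ∂(repMeasure Φ v) := by
  rw [applyFun_eq hg, norm_cyclicMap, ← real_inner_self_eq_norm_sq, L2.inner_def]
  refine integral_congr_ae ?_
  filter_upwards [hg.coeFn_toLp] with x hx
  simp [hx, sq]

theorem tendsto_applyFun {v : E} {g : K → ℝ} (hg : MemLp g 2 (repMeasure Φ v))
    {f : ℕ → C(K, ℝ)}
    (hf : Tendsto (fun n => eLpNorm (⇑(f n) - g) 2 (repMeasure Φ v)) atTop (𝓝 0)) :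
    Tendsto (fun n => Φ (f n) v) atTop (𝓝 (applyFun Φ v g)) := by
  have h := (Lp.tendsto_Lp_iff_tendsto_eLpNorm'' (fun n => ⇑(f n))
    (fun n => memLp_continuousMap _ (f n) 2) g hg).2 hf
  rw [applyFun_eq hg]
  refine (((cyclicMap Φ v).continuous.tendsto _).comp h).congr fun n => ?_
  rw [Function.comp_apply, ← applyFun_eq, applyFun_continuousMap]

theorem starAlgHom_applyFun (f : C(K, ℝ)) {v : E} {g : K → ℝ}
    (hg : MemLp g 2 (repMeasure Φ v)) : Φ f (applyFun Φ v g) = applyFun Φ v (⇑f * g) := by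
  obtain ⟨u, hu⟩ := exists_tendsto_eLpNorm _ hg
  have h1 := ((Φ f).continuous.tendsto _).comp (tendsto_applyFun hg hu)
  have h2 := tendsto_eLpNorm_mul f.norm_coe_le_norm hu
  have h3 : MemLp (⇑f * g) 2 (repMeasure Φ v) :=
    hg.mul (memLp_continuousMap (repMeasure Φ v) f ∞)
  refine tendsto_nhds_unique h1 ((tendsto_applyFun (f := fun n => f * u n) h3
    (h2.congr fun n => ?_)).congr fun n => ?_)
  · rw [mul_sub]; rfl
  · exact starAlgHom_mul_apply Φ f (u n) v

/-- Multiplicativity compares two base vectors, v and g(Φ) v, hence two measures. Continuous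
approximants of h are taken for both at once; for them the identity is `starAlgHom_applyFun`, and g,
being bounded, preserves L² convergence. -/
theorem applyFun_mul {v : E} {g h : K → ℝ} (hg : Measurable g) {C : ℝ} (hC : ∀ x, ‖g x‖ ≤ C)
    (hh : Measurable h) {D : ℝ} (hD : ∀ x, ‖h x‖ ≤ D) :
    applyFun Φ (applyFun Φ v g) h = applyFun Φ v (g * h) := by
  have hg2 : ∀ (m : Measure K) [IsFiniteMeasure m], MemLp g 2 m := fun m _ =>
    MemLp.of_bound hg.aestronglyMeasurable C (Eventually.of_forall hC)
  have hh2 : ∀ (m : Measure K) [IsFiniteMeasure m], MemLp h 2 m := fun m _ =>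
    MemLp.of_bound hh.aestronglyMeasurable D (Eventually.of_forall hD)
  have hgh2 : MemLp (g * h) 2 (repMeasure Φ v) :=
    MemLp.of_bound (hg.mul hh).aestronglyMeasurable (C * D) (Eventually.of_forall fun x => by
      rw [Pi.mul_apply, norm_mul]
      exact mul_le_mul (hC x) (hD x) (norm_nonneg _) ((norm_nonneg _).trans (hC x)))
  -- Approximating in L² of the sum of the measures yields a single sequence that converges for each
  -- of them.
  obtain ⟨u, hu⟩ := exists_tendsto_eLpNorm (repMeasure Φ v + repMeasure Φ (applyFun Φ v g))
    (hh2 _)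
  have h1 := tendsto_applyFun (hh2 _) (tendsto_eLpNorm_mono (Measure.le_add_left le_rfl) hu)
  have h2 := tendsto_eLpNorm_mul hC
    (tendsto_eLpNorm_mono (Measure.le_add_right (μ := repMeasure Φ v) le_rfl) hu)
  have h4 : ∀ n, MemLp (g * (⇑(u n) - h)) 2 (repMeasure Φ v) := fun n => by
    have := ((hg2 _).mul (memLp_continuousMap (repMeasure Φ v) (u n) ∞)).sub hgh2
    rw [mul_comm (u n : K → ℝ) g, ← mul_sub] at this
    exact this
  have h3 : ∀ n, Φ (u n) (applyFun Φ v g) - applyFun Φ v (g * h)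
      = applyFun Φ v (g * (⇑(u n) - h)) := fun n => by
    rw [starAlgHom_applyFun _ (hg2 _), sub_eq_iff_eq_add, ← applyFun_add (h4 n) hgh2]
    congr 1
    ring
  refine tendsto_nhds_unique h1 (tendsto_iff_norm_sub_tendsto_zero.2 ?_)
  have h5 := (ENNReal.tendsto_toReal (by simp : (0 : ℝ≥0∞) ≠ ∞)).comp h2
  refine h5.congr fun n => ?_
  rw [h3, applyFun_eq (h4 n), norm_cyclicMap, Lp.norm_toLp]
  rfl

theorem applyFun_add_left {g : K → ℝ} (hg : Measurable g) {C : ℝ} (hC : ∀ x, ‖g x‖ ≤ C)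
    (v w : E) : applyFun Φ (v + w) g = applyFun Φ v g + applyFun Φ w g := by
  have hg2 : ∀ (m : Measure K) [IsFiniteMeasure m], MemLp g 2 m := fun m _ =>
    MemLp.of_bound hg.aestronglyMeasurable C (Eventually.of_forall hC)
  obtain ⟨u, hu⟩ := exists_tendsto_eLpNorm
    (repMeasure Φ v + (repMeasure Φ w + repMeasure Φ (v + w))) (hg2 _)
  have h1 := tendsto_applyFun (hg2 _) (tendsto_eLpNorm_mono
    (m := repMeasure Φ (v + w)) (Measure.le_add_left (Measure.le_add_left le_rfl)) hu)
  have h2 := tendsto_applyFun (hg2 _) (tendsto_eLpNorm_mono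
    (m := repMeasure Φ w) (Measure.le_add_left (Measure.le_add_right le_rfl)) hu)
  have h3 := tendsto_applyFun (hg2 _) (tendsto_eLpNorm_mono
    (m := repMeasure Φ v) (Measure.le_add_right le_rfl) hu)
  exact tendsto_nhds_unique h1 ((h3.add h2).congr fun n => (map_add _ _ _).symm)

theorem applyFun_smul_left {g : K → ℝ} (hg : Measurable g) {C : ℝ} (hC : ∀ x, ‖g x‖ ≤ C)
    (c : ℂ) (v : E) : applyFun Φ (c • v) g = c • applyFun Φ v g := by
  have hg2 : ∀ (m : Measure K) [IsFiniteMeasure m], MemLp g 2 m := fun m _ =>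
    MemLp.of_bound hg.aestronglyMeasurable C (Eventually.of_forall hC)
  obtain ⟨u, hu⟩ := exists_tendsto_eLpNorm (repMeasure Φ v + repMeasure Φ (c • v)) (hg2 _)
  have h1 := tendsto_applyFun (hg2 _) (tendsto_eLpNorm_mono
    (m := repMeasure Φ (c • v)) (Measure.le_add_left le_rfl) hu)
  have h3 := tendsto_applyFun (hg2 _) (tendsto_eLpNorm_mono
    (m := repMeasure Φ v) (Measure.le_add_right le_rfl) hu)
  exact tendsto_nhds_unique h1 ((h3.const_smul c).congr fun n => (map_smul _ _ _).symm)

theorem inner_applyFun_left {g : K → ℝ} (hg : Measurable g) {C : ℝ} (hC : ∀ x, ‖g x‖ ≤ C)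
    (v w : E) : ⟪applyFun Φ v g, w⟫_ℂ = ⟪v, applyFun Φ w g⟫_ℂ := by
  have hg2 : ∀ (m : Measure K) [IsFiniteMeasure m], MemLp g 2 m := fun m _ =>
    MemLp.of_bound hg.aestronglyMeasurable C (Eventually.of_forall hC)
  obtain ⟨u, hu⟩ := exists_tendsto_eLpNorm (repMeasure Φ v + repMeasure Φ w) (hg2 _)
  have h1 := tendsto_applyFun (hg2 _) (tendsto_eLpNorm_mono
    (m := repMeasure Φ w) (Measure.le_add_left le_rfl) hu)
  have h3 := tendsto_applyFun (hg2 _) (tendsto_eLpNorm_mono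
    (m := repMeasure Φ v) (Measure.le_add_right le_rfl) hu)
  exact tendsto_nhds_unique (h3.inner tendsto_const_nhds)
    ((tendsto_const_nhds.inner h1).congr fun n => (inner_starAlgHom_left Φ _ _ _).symm)

end ContinuousCalculus

/-! ### The projection-valued measure -/

section Construction

variable {K : Type*}

theorem norm_indicator_one_le (S : Set K) (x : K) :
    ‖S.indicator (1 : K → ℝ) x‖ ≤ 1 := by
  by_cases h : x ∈ S <;> simp [h]

variable [MeasurableSpace K]

theorem memLp_indicator_one (m : Measure K) [IsFiniteMeasure m] {S : Set K}
    (hS : MeasurableSet S) : MemLp (S.indicator (1 : K → ℝ)) 2 m :=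
  MemLp.of_bound (measurable_one.indicator hS).aestronglyMeasurable 1
    (Eventually.of_forall (norm_indicator_one_le S))

variable [MetricSpace K] [CompactSpace K] [BorelSpace K]
  {E : Type*} [NormedAddCommGroup E] [InnerProductSpace ℂ E] [CompleteSpace E]
  {Φ : C(K, ℝ) →⋆ₐ[ℝ] (E →L[ℂ] E)}

theorem norm_sq_applyFun_indicator (v : E) {S : Set K} (hS : MeasurableSet S) :
    ‖applyFun Φ v (S.indicator 1)‖ ^ 2 = (repMeasure Φ v).real S := by
  rw [norm_sq_applyFun (memLp_indicator_one _ hS), ← integral_indicator_one hS]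
  refine integral_congr_ae (Eventually.of_forall fun x => ?_)
  by_cases h : x ∈ S <;> simp [h]

theorem repMeasure_real_univ (v : E) : (repMeasure Φ v).real univ = ‖v‖ ^ 2 := by
  have h := applyFun_continuousMap Φ v 1
  rw [map_one] at h
  rw [← norm_sq_applyFun_indicator v MeasurableSet.univ, indicator_univ]
  congr 2

variable (Φ) in
/-- The operator `1_S(Φ)`. -/
def spectralOp (S : Set K) (hS : MeasurableSet S) : E →L[ℂ] E :=
  LinearMap.mkContinuous
    { toFun := fun v => applyFun Φ v (S.indicator 1)
      map_add' := applyFun_add_left (measurable_one.indicator hS) (norm_indicator_one_le S)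
      map_smul' := applyFun_smul_left (measurable_one.indicator hS) (norm_indicator_one_le S) }
    1 (fun v => by
      rw [one_mul, ← sq_le_sq₀ (norm_nonneg _) (norm_nonneg _)]
      refine (norm_sq_applyFun_indicator v hS).trans_le ?_
      rw [← repMeasure_real_univ (Φ := Φ)]
      exact measureReal_mono (subset_univ S))

theorem spectralOp_apply {S : Set K} (hS : MeasurableSet S) (v : E) :
    spectralOp Φ S hS v = applyFun Φ v (S.indicator 1) := rfl

theorem spectralOp_inter {S T : Set K} (hS : MeasurableSet S) (hT : MeasurableSet T) :
    spectralOp Φ (S ∩ T) (hS.inter hT) = spectralOp Φ S hS ∘L spectralOp Φ T hT := by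
  ext v
  rw [ContinuousLinearMap.comp_apply]
  simp only [spectralOp_apply]
  rw [applyFun_mul (measurable_one.indicator hT) (norm_indicator_one_le T)
    (measurable_one.indicator hS) (norm_indicator_one_le S), inter_comm, inter_indicator_one]

theorem isStarProjection_spectralOp {S : Set K} (hS : MeasurableSet S) :
    IsStarProjection (spectralOp Φ S hS) := by
  refine ⟨?_, ?_⟩
  · have h := spectralOp_inter (Φ := Φ) hS hS
    simp only [inter_self] at h
    exact h.symm
  · rw [ContinuousLinearMap.isSelfAdjoint_iff_isSymmetric]
    exact inner_applyFun_left (measurable_one.indicator hS) (norm_indicator_one_le S)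

theorem norm_sq_spectralOp {S : Set K} (hS : MeasurableSet S) (v : E) :
    ‖spectralOp Φ S hS v‖ ^ 2 = (repMeasure Φ v).real S :=
  norm_sq_applyFun_indicator v hS

theorem spectralOp_union {S T : Set K} (hS : MeasurableSet S) (hT : MeasurableSet T)
    (h : Disjoint S T) (v : E) :
    spectralOp Φ (S ∪ T) (hS.union hT) v = spectralOp Φ S hS v + spectralOp Φ T hT v := by
  simp only [spectralOp_apply]
  rw [indicator_union_of_disjoint h, ← applyFun_add (memLp_indicator_one _ hS)
    (memLp_indicator_one _ hT)]
  rfl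

theorem spectralOp_empty (v : E) : spectralOp Φ ∅ MeasurableSet.empty v = 0 := by
  have h := norm_sq_spectralOp (Φ := Φ) MeasurableSet.empty v
  simpa using h

theorem spectralOp_biUnion {S : ℕ → Set K} (hS : ∀ n, MeasurableSet (S n))
    (hd : Pairwise (fun m n => Disjoint (S m) (S n))) (s : Finset ℕ) (v : E) :
    ∑ n ∈ s, spectralOp Φ (S n) (hS n) v =
      spectralOp Φ (⋃ n ∈ s, S n) (s.measurableSet_biUnion fun n _ => hS n) v := by
  classical
  induction s using Finset.induction_on with
  | empty => simpa using (spectralOp_empty (Φ := Φ) v).symm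
  | insert a s ha ih =>
    rw [Finset.sum_insert ha, ih, ← spectralOp_union]
    · simp only [Finset.set_biUnion_insert]
    · rw [disjoint_iUnion₂_right]
      exact fun i hi => hd fun h => ha (h ▸ hi)

theorem hasSum_spectralOp {S : ℕ → Set K} (hS : ∀ n, MeasurableSet (S n))
    (hd : Pairwise (fun m n => Disjoint (S m) (S n))) (v : E) :
    HasSum (fun n => spectralOp Φ (S n) (hS n) v)
      (spectralOp Φ (⋃ n, S n) (MeasurableSet.iUnion hS) v) := by
  have h1 : HasSum (fun n => (repMeasure Φ v).real (S n))
      ((repMeasure Φ v).real (⋃ n, S n)) := by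
    have h2 := measure_iUnion (μ := repMeasure Φ v) hd hS
    have h3 : ∑' n, repMeasure Φ v (S n) ≠ ∞ := by
      rw [← h2]
      exact measure_ne_top _ _
    rw [measureReal_def, h2, ENNReal.tsum_toReal_eq (fun n => measure_ne_top _ _)]
    exact (ENNReal.summable_toReal h3).hasSum
  rw [HasSum, SummationFilter.unconditional_filter, tendsto_iff_norm_sub_tendsto_zero]
  -- The error of a partial sum is the projection of v for the leftover set, and its squared norm is
  -- the m_v-measure of that set.
  have h4 : ∀ s : Finset ℕ, ‖∑ n ∈ s, spectralOp Φ (S n) (hS n) v -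
      spectralOp Φ (⋃ n, S n) (MeasurableSet.iUnion hS) v‖ =
      √((repMeasure Φ v).real (⋃ n, S n) - ∑ n ∈ s, (repMeasure Φ v).real (S n)) := fun s => by
    have hU : MeasurableSet (⋃ n ∈ s, S n) := s.measurableSet_biUnion fun n _ => hS n
    have hD := (MeasurableSet.iUnion hS).diff hU
    have hsub : (⋃ n ∈ s, S n) ⊆ ⋃ n, S n := iUnion₂_subset fun n _ => subset_iUnion S n
    have h5 := spectralOp_union (Φ := Φ) hU hD disjoint_sdiff_right v
    simp only [union_sdiff_cancel hsub] at h5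
    rw [spectralOp_biUnion hS hd, h5, sub_add_cancel_left, norm_neg,
      ← measureReal_biUnion_finset (fun i _ j _ hij => hd hij) (fun n _ => hS n),
      ← measureReal_sdiff hsub hU, ← norm_sq_spectralOp hD, Real.sqrt_sq (norm_nonneg _)]
  simp only [h4]
  have h6 := (tendsto_const_nhds (x := (repMeasure Φ v).real (⋃ n, S n))).sub h1
  rw [sub_self] at h6
  simpa using h6.sqrt

open Classical in
variable (Φ) in
/-- The projection-valued measure of `φ(Φ)` for a measurable function `φ`. -/
def pvmOfStarAlgHom (φ : K → ℝ) (hφ : Measurable φ) : ProjectionValuedMeasure E where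
  proj S := if hS : MeasurableSet S then spectralOp Φ (φ ⁻¹' S) (hφ hS) else 0
  isStarProjection S hS := by
    rw [dif_pos hS]
    exact isStarProjection_spectralOp _
  univ := by
    rw [dif_pos MeasurableSet.univ]
    ext v
    have h := applyFun_continuousMap Φ v 1
    rw [map_one] at h
    rw [← h, spectralOp_apply, preimage_univ, indicator_univ]
    congr 1
  inter S T hS hT := by
    rw [dif_pos hS, dif_pos hT, dif_pos (hS.inter hT), ← spectralOp_inter]
    rfl
  iUnion S hS hd v := by
    simp only [dif_pos (hS _), dif_pos (MeasurableSet.iUnion hS), preimage_iUnion]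
    exact hasSum_spectralOp _ (fun m n h => (hd h).preimage φ) v

theorem ProjectionValuedMeasure.scalar_apply (P : ProjectionValuedMeasure E) (v : E) {S : Set ℝ}
    (hS : MeasurableSet S) : P.scalar v S = ENNReal.ofReal (‖P.proj S v‖ ^ 2) := by
  rw [ProjectionValuedMeasure.scalar, Measure.ofMeasurable_apply S hS]
  have h := P.isStarProjection S hS
  have h1 : ⟪v, P.proj S v⟫_ℂ = ⟪P.proj S v, P.proj S v⟫_ℂ := by
    conv_lhs => rw [← h.isIdempotentElem.eq]
    rw [ContinuousLinearMap.mul_def, ContinuousLinearMap.comp_apply,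
      ← ContinuousLinearMap.adjoint_inner_left, h.isSelfAdjoint.adjoint_eq]
  rw [h1, inner_self_eq_norm_sq_to_K]
  norm_cast

theorem scalar_pvmOfStarAlgHom {φ : K → ℝ} (hφ : Measurable φ) (v : E) :
    (pvmOfStarAlgHom Φ φ hφ).scalar v = (repMeasure Φ v).map φ := by
  ext S hS
  rw [ProjectionValuedMeasure.scalar_apply _ _ hS, Measure.map_apply hφ hS]
  simp only [pvmOfStarAlgHom, dif_pos hS]
  rw [norm_sq_spectralOp, ofReal_measureReal]

/-- Because ⟨Φ f v, Φ g Φ f v⟩ = ⟨v, Φ(f g f) v⟩. For f(x) = x this describes the spectral measures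
of vectors R y, that is, of the domain of A. -/
theorem repMeasure_starAlgHom_apply (f : C(K, ℝ)) (v : E) :
    repMeasure Φ (Φ f v) = (repMeasure Φ v).withDensity fun x => ENNReal.ofReal (f x ^ 2) := by
  have hf : ∀ x, f x ^ 2 ≤ ‖f‖ ^ 2 := fun x => by
    rw [← sq_abs]
    exact pow_le_pow_left₀ (abs_nonneg _) (f.norm_coe_le_norm x) 2
  have : IsFiniteMeasure ((repMeasure Φ v).withDensity fun x => ENNReal.ofReal (f x ^ 2)) := by
    refine isFiniteMeasure_withDensity_ofReal ?_
    exact (memLp_continuousMap (repMeasure Φ v) (f ^ 2) 1).integrable le_rfl |>.2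
  refine ext_of_forall_integral_eq_of_IsFiniteMeasure fun g => ?_
  have h1 := integral_repMeasure Φ (Φ f v) g.toContinuousMap
  have h2 := integral_repMeasure Φ v (f * (g.toContinuousMap * f))
  rw [starAlgHom_mul_apply, starAlgHom_mul_apply, ← inner_starAlgHom_left, ← h1] at h2
  refine h2.symm.trans ?_
  have h3 : (fun x => ENNReal.ofReal (f x ^ 2)) = fun x => ((f x ^ 2).toNNReal : ℝ≥0∞) := rfl
  rw [h3, integral_withDensity_eq_integral_smul (by fun_prop)]
  refine integral_congr_ae (Eventually.of_forall fun x => ?_)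
  simp only [ContinuousMap.mul_apply, NNReal.smul_def, Real.coe_toNNReal _ (sq_nonneg (f x)),
    smul_eq_mul]
  change f x * (g x * f x) = _
  ring

end Construction

/-! ### The resolvent of a positive self-adjoint operator -/

section Unbounded

variable {E : Type*} [NormedAddCommGroup E] [InnerProductSpace ℂ E] {A : E →ₗ.[ℂ] E}

/-- Positivity gives ‖v‖² ≤ Re⟨v, v + Av⟩, then Cauchy-Schwarz. This one estimate yields injectivity
and closed range of 1 + A, and ‖R‖ ≤ 1. -/
theorem norm_le_norm_add_apply (hA_pos : ∀ v : A.domain, 0 ≤ (⟪(v : E), A v⟫_ℂ).re)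
    (v : A.domain) : ‖(v : E)‖ ≤ ‖(v : E) + A v‖ := by
  have h1 : ‖(v : E)‖ ^ 2 ≤ (⟪(v : E), v + A v⟫_ℂ).re := by
    rw [inner_add_right, Complex.add_re]
    have h : (⟪(v : E), (v : E)⟫_ℂ).re = ‖(v : E)‖ ^ 2 := inner_self_eq_norm_sq (𝕜 := ℂ) _
    have := hA_pos v
    linarith
  have h2 : (⟪(v : E), v + A v⟫_ℂ).re ≤ ‖(v : E)‖ * ‖(v : E) + A v‖ :=
    (Complex.re_le_norm _).trans (norm_inner_le_norm _ _)
  by_contra! h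
  have := norm_nonneg ((v : E) + A v)
  nlinarith

variable (A) in
/-- The linear map `1 + A` on the domain of `A`. -/
def oneAdd : A.domain →ₗ[ℂ] E := A.domain.subtype + A.toFun

theorem oneAdd_apply (v : A.domain) : oneAdd A v = v + A v := rfl

theorem oneAdd_injective (hA_pos : ∀ v : A.domain, 0 ≤ (⟪(v : E), A v⟫_ℂ).re) :
    Function.Injective (oneAdd A) := by
  refine (injective_iff_map_eq_zero _).2 fun v hv => ?_
  have h := norm_le_norm_add_apply hA_pos v
  rw [← oneAdd_apply, hv, norm_zero] at h
  exact Subtype.ext (norm_le_zero_iff.1 h)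

variable [CompleteSpace E]

theorem inner_apply_of_isSelfAdjoint (hA : IsSelfAdjoint A) (v w : A.domain) :
    ⟪A v, (w : E)⟫_ℂ = ⟪(v : E), A w⟫_ℂ := by
  have h := LinearPMap.adjoint_isFormalAdjoint (T := A) hA.dense_domain
  rw [LinearPMap.isSelfAdjoint_def.1 hA] at h
  exact h v w

theorem mem_domain_of_isSelfAdjoint (hA : IsSelfAdjoint A) {w z : E}
    (h : ∀ v : A.domain, ⟪z, (v : E)⟫_ℂ = ⟪w, A v⟫_ℂ) : ∃ hw : w ∈ A.domain, A ⟨w, hw⟩ = z := by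
  have h1 := LinearPMap.mem_adjoint_domain_of_exists (T := A) w ⟨z, h⟩
  have h2 := LinearPMap.adjoint_apply_eq (T := A) hA.dense_domain ⟨w, h1⟩ h
  -- The membership proof depends on the operator, so A† = A is substituted for a generic B.
  have h3 : ∀ B : E →ₗ.[ℂ] E, B = A → ∀ hw : w ∈ B.domain, B ⟨w, hw⟩ = z →
      ∃ hw : w ∈ A.domain, A ⟨w, hw⟩ = z := by
    rintro _ rfl hw h
    exact ⟨hw, h⟩
  exact h3 _ (LinearPMap.isSelfAdjoint_def.1 hA) h1 h2

theorem isClosed_range_oneAdd (hA : IsSelfAdjoint A)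
    (hA_pos : ∀ v : A.domain, 0 ≤ (⟪(v : E), A v⟫_ℂ).re) :
    IsClosed ((LinearMap.range (oneAdd A) : Submodule ℂ E) : Set E) := by
  refine IsSeqClosed.isClosed fun y z hy hz => ?_
  choose u hu using hy
  have hc : CauchySeq fun n => (u n : E) := by
    have h1 := hz.cauchySeq
    rw [Metric.cauchySeq_iff] at h1 ⊢
    intro ε hε
    obtain ⟨N, hN⟩ := h1 ε hε
    refine ⟨N, fun m hm n hn => lt_of_le_of_lt ?_ (hN m hm n hn)⟩
    have h2 := norm_le_norm_add_apply hA_pos (u m - u n)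
    rw [← oneAdd_apply, map_sub, hu, hu] at h2
    rw [dist_eq_norm, dist_eq_norm]
    exact h2
  obtain ⟨v, hv⟩ := cauchySeq_tendsto_of_complete hc
  have h3 : Tendsto (fun n => A (u n)) atTop (𝓝 (z - v)) := by
    refine (hz.sub hv).congr fun n => ?_
    rw [← hu, oneAdd_apply, add_sub_cancel_left]
  have h4 : ((v, z - v) : E × E) ∈ A.graph := by
    have h5 : IsClosed (A.graph : Set (E × E)) := hA.isClosed
    refine h5.mem_of_tendsto (hv.prodMk_nhds h3) (Eventually.of_forall fun n => ?_)
    exact A.mem_graph (u n)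
  rw [LinearPMap.mem_graph_iff] at h4
  obtain ⟨w, hw1, hw2⟩ := h4
  refine ⟨w, ?_⟩
  rw [oneAdd_apply, hw1, hw2]
  exact add_sub_cancel _ _

/-- A vector w orthogonal to the closed range satisfies A w = -w by self-adjointness, and positivity
forces w = 0. -/
theorem oneAdd_surjective (hA : IsSelfAdjoint A)
    (hA_pos : ∀ v : A.domain, 0 ≤ (⟪(v : E), A v⟫_ℂ).re) :
    Function.Surjective (oneAdd A) := by
  rw [← LinearMap.range_eq_top]
  have hcl := isClosed_range_oneAdd hA hA_pos
  have : CompleteSpace (LinearMap.range (oneAdd A)) := hcl.completeSpace_coe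
  rw [← Submodule.orthogonal_eq_bot_iff, Submodule.eq_bot_iff]
  intro w hw
  rw [Submodule.mem_orthogonal'] at hw
  have h1 : ∀ v : A.domain, ⟪-w, (v : E)⟫_ℂ = ⟪w, A v⟫_ℂ := fun v => by
    have := hw _ ⟨v, rfl⟩
    rw [oneAdd_apply, inner_add_right] at this
    rw [inner_neg_left, neg_eq_iff_add_eq_zero, this]
  obtain ⟨hwA, hw2⟩ := mem_domain_of_isSelfAdjoint hA h1
  have h2 := hA_pos ⟨w, hwA⟩
  have h : (⟪w, w⟫_ℂ).re = ‖w‖ ^ 2 := inner_self_eq_norm_sq (𝕜 := ℂ) _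
  rw [hw2, inner_neg_right, Complex.neg_re, h] at h2
  have h3 : ‖w‖ ^ 2 = 0 := le_antisymm (by linarith) (sq_nonneg _)
  simpa using h3

/-- The resolvent `(1 + A)⁻¹` of a positive self-adjoint operator. -/
theorem exists_resolvent (hA : IsSelfAdjoint A)
    (hA_pos : ∀ v : A.domain, 0 ≤ (⟪(v : E), A v⟫_ℂ).re) :
    ∃ R : E →L[ℂ] E, IsSelfAdjoint R ∧
      (∀ y, ∃ h : R y ∈ A.domain, A ⟨R y, h⟩ = y - R y) ∧ ∀ v ∈ A.domain, ∃ y, R y = v := by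
  let e := LinearEquiv.ofBijective (oneAdd A) ⟨oneAdd_injective hA_pos, oneAdd_surjective hA hA_pos⟩
  have he : ∀ y, (e.symm y : E) + A (e.symm y) = y := fun y => e.apply_symm_apply y
  let R : E →L[ℂ] E := LinearMap.mkContinuous (A.domain.subtype ∘ₗ e.symm.toLinearMap) 1 fun y => by
    have h := norm_le_norm_add_apply hA_pos (e.symm y)
    rw [he] at h
    rw [one_mul]
    exact h
  have hR : ∀ y, R y = e.symm y := fun y => rfl
  refine ⟨R, ?_, fun y => ⟨(e.symm y).2, ?_⟩, fun v hv => ⟨e ⟨v, hv⟩, ?_⟩⟩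
  · rw [ContinuousLinearMap.isSelfAdjoint_iff_isSymmetric]
    intro y z
    change ⟪(e.symm y : E), z⟫_ℂ = ⟪y, (e.symm z : E)⟫_ℂ
    have h1 := he y
    have h2 := he z
    conv_lhs => rw [← h2]
    conv_rhs => rw [← h1]
    rw [inner_add_left, inner_add_right, inner_apply_of_isSelfAdjoint hA]
  · exact eq_sub_of_add_eq' (he y)
  · rw [hR, e.symm_apply_apply]

end Unbounded

/-! ### The spectral theorem for positive self-adjoint operators -/

section SpectralTheorem

variable {E : Type*} [NormedAddCommGroup E] [InnerProductSpace ℂ E] [CompleteSpace E]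
  {A : E →ₗ.[ℂ] E}

theorem inner_starAlgHom_self {K : Type*} [MetricSpace K] [CompactSpace K] [MeasurableSpace K]
    [BorelSpace K] (Φ : C(K, ℝ) →⋆ₐ[ℝ] (E →L[ℂ] E)) (f : C(K, ℝ)) (v : E) :
    ⟪v, Φ f v⟫_ℂ = ((∫ x, f x ∂(repMeasure Φ v) : ℝ) : ℂ) := by
  rw [integral_repMeasure, eq_comm, ← Complex.conj_eq_iff_re, inner_conj_symm,
    inner_starAlgHom_left]

/-- With Φ r = (1 + A)⁻¹ and r(x) = x, formally A = 1/r - 1; the domain of A is the range of Φ r. -/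
theorem isSpectralMeasure_of_resolvent {K : Set ℝ} [CompactSpace K]
    (Φ : C(K, ℝ) →⋆ₐ[ℝ] (E →L[ℂ] E)) (r : C(K, ℝ)) (hr : ∀ x, r x = x)
    (h1 : ∀ y, ∃ h : Φ r y ∈ A.domain, A ⟨Φ r y, h⟩ = y - Φ r y)
    (h2 : ∀ v ∈ A.domain, ∃ y, Φ r y = v) :
    IsSpectralMeasure A (pvmOfStarAlgHom Φ (fun x : K => (x : ℝ)⁻¹ - 1) (by fun_prop)) := by
  have hφ : Measurable fun x : K => (x : ℝ)⁻¹ - 1 := by fun_prop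
  have hinj : ∀ y, Φ r y = 0 → y = 0 := fun y hy => by
    obtain ⟨h, h'⟩ := h1 y
    have h3 : (⟨Φ r y, h⟩ : A.domain) = 0 := Subtype.ext hy
    rw [h3, hy, A.map_zero, sub_zero] at h'
    exact h'.symm
  -- The resolvent kills 1_{0}(Φ) v, because x · 1_{0}(x) = 0; being injective, it leaves no mass of
  -- m_v at 0.
  have hae : ∀ v, ∀ᵐ x : K ∂(repMeasure Φ v), (x : ℝ) ≠ 0 := fun v => by
    have hm : MeasurableSet {x : K | (x : ℝ) = 0} :=
      measurableSet_eq_fun (by fun_prop) (by fun_prop)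
    have h3 := starAlgHom_applyFun r (memLp_indicator_one (repMeasure Φ v) hm)
    have h4 : ⇑r * {x : K | (x : ℝ) = 0}.indicator 1 = ⇑(0 : C(K, ℝ)) := by
      ext x
      by_cases hx : (x : ℝ) = 0 <;> simp [hx, hr]
    rw [h4, applyFun_continuousMap, map_zero] at h3
    have h5 := norm_sq_applyFun_indicator (Φ := Φ) v hm
    rw [hinj _ h3, norm_zero, zero_pow two_ne_zero, eq_comm, measureReal_eq_zero_iff] at h5
    rw [ae_iff]
    simpa using h5
  refine ⟨fun v => ?_, fun v => ?_⟩
  · rw [scalar_pvmOfStarAlgHom, lintegral_map (by fun_prop) hφ]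
    constructor
    · intro hv
      obtain ⟨y, rfl⟩ := h2 v hv
      rw [repMeasure_starAlgHom_apply, lintegral_withDensity_eq_lintegral_mul _ (by fun_prop)
        (by fun_prop)]
      -- For v = R y the integrand against m_y is x²(1/x - 1)² = (1 - x)², which is bounded on K.
      refine lt_of_le_of_lt (lintegral_mono_ae (g := fun _ => ENNReal.ofReal ((1 + ‖r‖) ^ 2)) ?_) ?_
      · filter_upwards [hae y] with x hx
        rw [Pi.mul_apply, ← ENNReal.ofReal_mul (sq_nonneg _)]
        refine ENNReal.ofReal_le_ofReal ?_
        rw [← mul_pow, hr, mul_sub, mul_inv_cancel₀ hx, mul_one, ← sq_abs]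
        refine pow_le_pow_left₀ (abs_nonneg _) ?_ 2
        have h3 := r.norm_coe_le_norm x
        rw [hr, Real.norm_eq_abs] at h3
        exact (abs_sub _ _).trans (by rw [abs_one]; linarith)
      · rw [lintegral_const]
        exact ENNReal.mul_lt_top ENNReal.ofReal_lt_top (measure_lt_top _ _)
    · intro hfin
      have h3 : MemLp (fun x : K => (x : ℝ)⁻¹ - 1) 2 (repMeasure Φ v) := by
        rw [memLp_two_iff_integrable_sq hφ.aestronglyMeasurable]
        refine ⟨(hφ.pow_const 2).aestronglyMeasurable, ?_⟩
        rw [hasFiniteIntegral_iff_ofReal (Eventually.of_forall fun x => sq_nonneg _)]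
        exact hfin
      have h4 : MemLp (fun x : K => (x : ℝ)⁻¹) 2 (repMeasure Φ v) := by
        have := h3.add (memLp_continuousMap (repMeasure Φ v) 1 2)
        refine (memLp_congr_ae (Eventually.of_forall fun x => ?_)).1 this
        simp
      have h5 := starAlgHom_applyFun r h4
      have h6 : ⇑r * (fun x : K => (x : ℝ)⁻¹) =ᵐ[repMeasure Φ v] ⇑(1 : C(K, ℝ)) := by
        filter_upwards [hae v] with x hx
        simp [hr, hx]
      rw [← applyFun_congr (memLp_continuousMap _ 1 2) h6.symm, applyFun_continuousMap,
        map_one] at h5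
      -- Finiteness puts 1/x in L²(m_v), so v = R w for w = (1/x)(Φ) v.
      have h7 := (h1 (applyFun Φ v fun x : K => (x : ℝ)⁻¹)).1
      rw [h5] at h7
      exact h7
  · rw [scalar_pvmOfStarAlgHom, integral_map hφ.aemeasurable (by fun_prop)]
    obtain ⟨v, hv⟩ := v
    obtain ⟨y, rfl⟩ := h2 v hv
    obtain ⟨h, h'⟩ := h1 y
    have h3 : (⟪Φ r y, y - Φ r y⟫_ℂ) = ⟪y, Φ (r - r * r) y⟫_ℂ := by
      rw [inner_starAlgHom_left, map_sub, map_sub, ← starAlgHom_mul_apply]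
      rfl
    have h4 : (fun x : K => ENNReal.ofReal (r x ^ 2)) = fun x => ((r x ^ 2).toNNReal : ℝ≥0∞) := rfl
    rw [h', h3, inner_starAlgHom_self, repMeasure_starAlgHom_apply, h4,
      integral_withDensity_eq_integral_smul (by fun_prop)]
    congr 1
    refine integral_congr_ae (Eventually.of_forall fun x => ?_)
    simp only [NNReal.smul_def, smul_eq_mul, ContinuousMap.sub_apply, ContinuousMap.mul_apply, hr,
      Real.coe_toNNReal _ (sq_nonneg (x : ℝ))]
    -- At x = 0 the convention 0⁻¹ = 0 is harmless: the weight x² vanishes.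
    by_cases hx : (x : ℝ) = 0
    · simp [hx]
    · field_simp

theorem exists_isSpectralMeasure (hA : IsSelfAdjoint A)
    (hA_pos : ∀ v : A.domain, 0 ≤ (⟪(v : E), A v⟫_ℂ).re) :
    ∃ P, IsSpectralMeasure A P := by
  obtain ⟨R, hR, h1, h2⟩ := exists_resolvent hA hA_pos
  have hid : cfcHom hR ((ContinuousMap.id ℝ).restrict (spectrum ℝ R)) = R := cfcHom_id hR
  exact ⟨_, isSpectralMeasure_of_resolvent (cfcHom hR) _ (fun x => rfl)
    (fun y => by rw [hid]; exact h1 y) (fun v hv => by rw [hid]; exact h2 v hv)⟩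

end SpectralTheorem

/-! ### Consequences of positivity for the spectral measure -/

section SpectralMeasure

variable {E : Type*} [NormedAddCommGroup E] [InnerProductSpace ℂ E] [CompleteSpace E]

namespace ProjectionValuedMeasure

variable (P : ProjectionValuedMeasure E)

theorem scalar_univ (v : E) : P.scalar v Set.univ = ENNReal.ofReal (‖v‖ ^ 2) := by
  rw [P.scalar_apply v MeasurableSet.univ, P.univ]
  rfl

instance (v : E) : IsFiniteMeasure (P.scalar v) :=
  ⟨by rw [scalar_univ]; exact ENNReal.ofReal_lt_top⟩

theorem scalar_proj {S : Set ℝ} (hS : MeasurableSet S) (v : E) :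
    P.scalar (P.proj S v) = (P.scalar v).restrict S := by
  ext T hT
  rw [Measure.restrict_apply hT, P.scalar_apply _ hT, P.scalar_apply _ (hT.inter hS),
    P.inter T S hT hS, ContinuousLinearMap.comp_apply]

theorem proj_apply_eq_zero_iff {S : Set ℝ} (hS : MeasurableSet S) (v : E) :
    P.proj S v = 0 ↔ P.scalar v S = 0 := by
  rw [P.scalar_apply v hS, ENNReal.ofReal_eq_zero]
  constructor
  · intro h
    simp [h]
  · intro h
    have := le_antisymm h (sq_nonneg _)
    simpa using this

theorem proj_union_apply {S T : Set ℝ} (hS : MeasurableSet S) (hT : MeasurableSet T)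
    (h : Disjoint S T) (v : E) : P.proj (S ∪ T) v = P.proj S v + P.proj T v := by
  have h0 : ∀ U : ℕ → Set ℝ, (∀ n, MeasurableSet (U n)) →
      Pairwise (fun m n => Disjoint (U m) (U n)) → P.proj (⋃ n, U n) v = ∑' n, P.proj (U n) v :=
    fun U hU hd => (P.iUnion U hU hd v).tsum_eq.symm
  have hempty : P.proj ∅ v = 0 := by
    rw [P.proj_apply_eq_zero_iff MeasurableSet.empty, measure_empty]
  let U : ℕ → Set ℝ := fun n => if n = 0 then S else if n = 1 then T else ∅
  have hU : ∀ n, MeasurableSet (U n) := fun n => by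
    simp only [U]
    split_ifs <;> simp [hS, hT]
  have hd : Pairwise (fun m n => Disjoint (U m) (U n)) := fun m n hmn => by
    simp only [U]
    split_ifs <;> simp_all [h.symm]
  have hUn : ⋃ n, U n = S ∪ T := by
    ext x
    simp only [mem_iUnion, mem_union, U]
    constructor
    · rintro ⟨n, hn⟩
      split_ifs at hn
      · exact Or.inl hn
      · exact Or.inr hn
      · exact hn.elim
    · rintro (hx | hx)
      · exact ⟨0, by simpa using hx⟩
      · exact ⟨1, by simpa using hx⟩
  have h1 := h0 U hU hd
  rw [hUn, tsum_eq_sum (s := {0, 1}) (fun n hn => by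
    have h2 : n ≠ 0 ∧ n ≠ 1 := by simpa using hn
    simp [U, h2.1, h2.2, hempty])] at h1
  simpa [U] using h1

end ProjectionValuedMeasure

variable {A : E →ₗ.[ℂ] E} {P : ProjectionValuedMeasure E}

theorem IsSpectralMeasure.proj_mem_domain (hP : IsSpectralMeasure A P) {S : Set ℝ}
    (hS : MeasurableSet S) {C : ℝ} (hC : ∀ t ∈ S, |t| ≤ C) (v : E) :
    P.proj S v ∈ A.domain := by
  rw [hP.1, P.scalar_proj hS]
  refine lt_of_le_of_lt (setLIntegral_mono (g := fun _ => ENNReal.ofReal (C ^ 2)) (by fun_prop)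
    fun t ht => ENNReal.ofReal_le_ofReal ?_) ?_
  · rw [← sq_abs]
    exact pow_le_pow_left₀ (abs_nonneg _) (hC t ht) 2
  · rw [lintegral_const]
    exact ENNReal.mul_lt_top ENNReal.ofReal_lt_top (measure_lt_top _ _)

/-- For w = P([a, b]) v one has 0 ≤ ⟨w, A w⟩ = ∫_{[a,b]} t dm ≤ b · m([a, b]) with b < 0. -/
theorem IsSpectralMeasure.scalar_Icc_eq_zero (hP : IsSpectralMeasure A P)
    (hA_pos : ∀ v : A.domain, 0 ≤ (⟪(v : E), A v⟫_ℂ).re) (a : ℝ) {b : ℝ} (hb : b < 0) (v : E) :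
    P.scalar v (Icc a b) = 0 := by
  have hC : ∀ t ∈ Icc a b, |t| ≤ |a| := fun t ht => by
    rw [abs_of_nonpos (ht.2.trans hb.le), abs_of_nonpos (ht.1.trans (ht.2.trans hb.le))]
    exact neg_le_neg ht.1
  have hw := hP.proj_mem_domain measurableSet_Icc hC v
  have h1 := hA_pos ⟨_, hw⟩
  rw [hP.2, Complex.ofReal_re, P.scalar_proj measurableSet_Icc] at h1
  have h2 : ∫ t in Icc a b, t ∂(P.scalar v) ≤ ∫ t in Icc a b, b ∂(P.scalar v) := by
    refine setIntegral_mono_on ?_ (integrable_const b) measurableSet_Icc fun t ht => ht.2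
    exact continuousOn_id.integrableOn_compact isCompact_Icc
  rw [setIntegral_const, smul_eq_mul] at h2
  have h3 : (P.scalar v).real (Icc a b) = 0 := by
    refine le_antisymm ?_ measureReal_nonneg
    by_contra! h
    nlinarith
  exact (measureReal_eq_zero_iff).1 h3

theorem IsSpectralMeasure.scalar_Iio_zero (hP : IsSpectralMeasure A P)
    (hA_pos : ∀ v : A.domain, 0 ≤ (⟪(v : E), A v⟫_ℂ).re) (v : E) :
    P.scalar v (Iio 0) = 0 := by
  have h : Iio (0 : ℝ) ⊆ ⋃ n : ℕ, Icc (-(n : ℝ)) (-((n : ℝ) + 1)⁻¹) := fun t ht => by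
    have ht' : 0 < -t := neg_pos.2 ht
    obtain ⟨n, hn⟩ := exists_nat_gt (max (-t) (-t)⁻¹)
    refine mem_iUnion.2 ⟨n, ?_, ?_⟩
    · linarith [le_max_left (-t) (-t)⁻¹]
    · have h1 : (-t)⁻¹ ≤ n + 1 := by linarith [le_max_right (-t) (-t)⁻¹]
      have h2 := inv_anti₀ (inv_pos.2 ht') h1
      rw [inv_inv] at h2
      linarith
  refine measure_mono_null h (measure_iUnion_null fun n => ?_)
  exact hP.scalar_Icc_eq_zero hA_pos _ (neg_neg_of_pos (by positivity)) v

/-- A zero of a nonnegative form is a minimum, so the first variation Re⟨u, A w⟩ vanishes for u in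
the dense domain. It is needed because `IsSpectralMeasure` prescribes only ⟨v, A v⟩, not A v. -/
theorem apply_eq_zero_of_inner_eq_zero (hA : IsSelfAdjoint A)
    (hA_pos : ∀ v : A.domain, 0 ≤ (⟪(v : E), A v⟫_ℂ).re) {w : A.domain}
    (hw : (⟪(w : E), A w⟫_ℂ).re = 0) : A w = 0 := by
  have h1 : ∀ u : A.domain, (⟪(u : E), A w⟫_ℂ).re = 0 := fun u => by
    have h2 : ∀ s : ℝ, 0 ≤ (⟪(u : E), A u⟫_ℂ).re + s * (2 * (⟪(u : E), A w⟫_ℂ).re) := fun s => by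
      have h3 := hA_pos (u + (s : ℂ) • w)
      have h4 : (⟪(w : E), A u⟫_ℂ).re = (⟪(u : E), A w⟫_ℂ).re := by
        rw [← inner_apply_of_isSelfAdjoint hA, ← inner_conj_symm, Complex.conj_re]
      rw [LinearPMap.map_add, LinearPMap.map_smul, Submodule.coe_add, Submodule.coe_smul,
        inner_add_left, inner_add_right, inner_add_right, inner_smul_left, inner_smul_right,
        inner_smul_left, inner_smul_right, Complex.conj_ofReal] at h3
      simp only [Complex.add_re, Complex.re_ofReal_mul, hw, h4, mul_zero, add_zero] at h3
      linarith
    by_contra hne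
    -- This s makes the expression, affine in s, equal to -1.
    have h5 := h2 (-((⟪(u : E), A u⟫_ℂ).re + 1) / (2 * (⟪(u : E), A w⟫_ℂ).re))
    rw [div_mul_cancel₀ _ (mul_ne_zero two_ne_zero hne)] at h5
    linarith
  refine hA.dense_domain.eq_zero_of_inner_right ℂ fun u hu => ?_
  refine Complex.ext (h1 ⟨u, hu⟩) ?_
  have h6 := h1 (Complex.I • ⟨u, hu⟩)
  rw [Submodule.coe_smul, inner_smul_left] at h6
  simpa using h6

theorem IsSpectralMeasure.apply_proj_singleton_zero (hP : IsSpectralMeasure A P)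
    (hA : IsSelfAdjoint A) (hA_pos : ∀ v : A.domain, 0 ≤ (⟪(v : E), A v⟫_ℂ).re) (v : E) :
    ∃ h : P.proj {0} v ∈ A.domain, A ⟨P.proj {0} v, h⟩ = 0 := by
  have h := hP.proj_mem_domain (measurableSet_singleton (0 : ℝ)) (C := 0) (by simp) v
  refine ⟨h, apply_eq_zero_of_inner_eq_zero hA hA_pos ?_⟩
  rw [hP.2, Complex.ofReal_re, P.scalar_proj (measurableSet_singleton 0), Measure.restrict_singleton]
  simp

theorem isSpectralMeasure_spectralMeasure (hA : IsSelfAdjoint A)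
    (hA_pos : ∀ v : A.domain, 0 ≤ (⟪(v : E), A v⟫_ℂ).re) :
    IsSpectralMeasure A (spectralMeasure A) :=
  Classical.epsilon_spec (exists_isSpectralMeasure hA hA_pos)

/-- The range of `χ_A(]t, ∞[)` is the orthogonal complement of the range of `χ_A([0, t])`. -/
theorem sub_spectralProjection_Icc (hA : IsSelfAdjoint A)
    (hA_pos : ∀ v : A.domain, 0 ≤ (⟪(v : E), A v⟫_ℂ).re) {t : ℝ} (ht : 0 ≤ t) (v : E) :
    v - spectralProjection A (Icc 0 t) v = spectralProjection A (Ioi t) v := by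
  have hP := isSpectralMeasure_spectralMeasure hA hA_pos
  have h1 : (spectralMeasure A).proj (Iio 0) v = 0 :=
    (ProjectionValuedMeasure.proj_apply_eq_zero_iff _ measurableSet_Iio v).2
      (hP.scalar_Iio_zero hA_pos v)
  have h2 : (spectralMeasure A).proj (Iio 0 ∪ (Icc 0 t ∪ Ioi t)) v = v := by
    rw [Icc_union_Ioi_eq_Ici ht, Iio_union_Ici, (spectralMeasure A).univ]
    rfl
  rw [ProjectionValuedMeasure.proj_union_apply _ measurableSet_Iio
      (measurableSet_Icc.union measurableSet_Ioi), h1, zero_add,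
    ProjectionValuedMeasure.proj_union_apply _ measurableSet_Icc measurableSet_Ioi] at h2
  · rw [sub_eq_iff_eq_add', eq_comm]
    exact h2
  · exact disjoint_left.2 fun x hx hx' => not_lt.2 hx.2 hx'
  · rw [Icc_union_Ioi_eq_Ici ht]
    exact disjoint_left.2 fun x hx hx' => not_lt.2 (mem_Ici.1 hx') (mem_Iio.1 hx)

theorem spectralProjection_Icc_eq_Ioc {t : ℝ} (ht : 0 ≤ t) {v : E}
    (hv : spectralProjection A {0} v = 0) :
    spectralProjection A (Icc 0 t) v = spectralProjection A (Ioc 0 t) v := by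
  have h1 : Icc 0 t = {0} ∪ Ioc 0 t := by
    rw [singleton_union, Ioc_insert_left ht]
  rw [h1, spectralProjection, ProjectionValuedMeasure.proj_union_apply _
    (measurableSet_singleton 0) measurableSet_Ioc (by simp)]
  exact (congrArg (· + _) hv).trans (zero_add _)

end SpectralMeasure

/-! ### Densities of measures that need not be σ-finite -/

section RadonNikodym

variable {X : Type*} [MeasurableSpace X]

/-- The Radon-Nikodym theorem for arbitrary measures absolutely continuous with respect to a
σ-finite measure. -/
theorem withDensity_rnDeriv_of_absolutelyContinuous {ν μ : Measure X} [SigmaFinite μ]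
    (h : ν ≪ μ) : μ.withDensity (ν.rnDeriv μ) = ν := by
  set S := ν.sigmaFiniteSetWRT μ
  have hS : MeasurableSet S := measurableSet_sigmaFiniteSetWRT
  -- Outside a maximal σ-finite part, ν is ∞ · μ.
  have h1 : ν = ν.restrict S + (∞ : ℝ≥0∞) • μ.restrict Sᶜ := by
    rw [← restrict_compl_sigmaFiniteSetWRT h, Measure.restrict_add_restrict_compl hS]
  have h2 : (ν.restrict S).HaveLebesgueDecomposition μ := inferInstance
  have h3 : ((∞ : ℝ≥0∞) • μ.restrict Sᶜ).HaveLebesgueDecomposition μ := inferInstance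
  have h4 : ν.HaveLebesgueDecomposition μ := by
    rw [h1]
    infer_instance
  exact Measure.withDensity_rnDeriv_eq ν μ h

end RadonNikodym

/-! ### Hilbert-Schmidt norms -/

section HilbertSchmidt

variable {E : Type*} [NormedAddCommGroup E] [InnerProductSpace ℂ E]

theorem enorm_sq_eq_ofReal {F : Type*} [NormedAddCommGroup F] (w : F) :
    ‖w‖ₑ ^ 2 = ENNReal.ofReal (‖w‖ ^ 2) := by
  rw [ENNReal.ofReal_pow (norm_nonneg _), ofReal_norm]

theorem enorm_sq_eq_tsum_inner {ι : Type*} (b : HilbertBasis ι ℂ E) (v : E) :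
    ‖v‖ₑ ^ 2 = ∑' i, ‖⟪b i, v⟫_ℂ‖ₑ ^ 2 := by
  have h := Complex.hasSum_re (b.hasSum_inner_mul_inner v v)
  have h1 : ∀ i, (⟪v, b i⟫_ℂ * ⟪b i, v⟫_ℂ).re = ‖⟪b i, v⟫_ℂ‖ ^ 2 := fun i => by
    rw [← inner_conj_symm, Complex.conj_mul', ← Complex.ofReal_pow, Complex.ofReal_re]
  have h2 : (⟪v, v⟫_ℂ).re = ‖v‖ ^ 2 := inner_self_eq_norm_sq (𝕜 := ℂ) v
  simp only [h1, h2] at h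
  simp only [enorm_sq_eq_ofReal]
  rw [← h.tsum_eq, ENNReal.ofReal_tsum_of_nonneg (fun i => by positivity) h.summable]

variable [CompleteSpace E]

/-- Both sides sum the squared matrix entries of T, by rows or by columns. -/
theorem formTrace_adjoint (T : E →L[ℂ] E) :
    formTrace (fun v => ‖T v‖ₑ ^ 2) = formTrace fun v => ‖ContinuousLinearMap.adjoint T v‖ₑ ^ 2 := by
  obtain ⟨b, hb⟩ := (exists_hilbertBasis ℂ E).choose_spec
  simp only [formTrace, enorm_sq_eq_tsum_inner b, hb]
  rw [ENNReal.tsum_comm]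
  refine tsum_congr fun i => tsum_congr fun j => ?_
  rw [ContinuousLinearMap.adjoint_inner_right, ← inner_conj_symm, RCLike.enorm_conj]

theorem formTrace_mono {p q : E → ℝ≥0∞} (h : ∀ v, p v ≤ q v) : formTrace p ≤ formTrace q :=
  ENNReal.tsum_le_tsum fun i => h i

theorem formTrace_const_mul (c : ℝ≥0∞) (q : E → ℝ≥0∞) :
    formTrace (fun v => c * q v) = c * formTrace q :=
  ENNReal.tsum_mul_left

/-- Taking adjoints moves the right factor T to the left, where its operator norm bounds each term.
-/
theorem formTrace_comp_le (S T : E →L[ℂ] E) :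
    formTrace (fun v => ‖S (T v)‖ₑ ^ 2) ≤ ‖T‖ₑ ^ 2 * formTrace fun v => ‖S v‖ₑ ^ 2 := by
  have h := formTrace_adjoint (S ∘L T)
  simp only [ContinuousLinearMap.adjoint_comp, ContinuousLinearMap.comp_apply] at h
  rw [h, formTrace_adjoint S, ← formTrace_const_mul]
  refine formTrace_mono fun v => ?_
  rw [← mul_pow]
  refine pow_le_pow_left' ?_ 2
  refine (ContinuousLinearMap.le_opENorm _ _).trans_eq ?_
  rw [← ofReal_norm, LinearIsometryEquiv.norm_map, ofReal_norm]

theorem norm_opSqrt_sq {ρ : E →L[ℂ] E} (hρ : ρ.IsPositive) :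
    ‖opSqrt ρ‖ ^ 2 = ‖ρ‖ := by
  have hρ' : 0 ≤ ρ := (ContinuousLinearMap.nonneg_iff_isPositive ρ).2 hρ
  have hs : IsSelfAdjoint (opSqrt ρ) := (CFC.sqrt_nonneg ρ).isSelfAdjoint
  rw [← hs.norm_mul_self, opSqrt, CFC.sqrt_mul_sqrt_self ρ hρ']

theorem opSqrt_of_isStarProjection {Q : E →L[ℂ] E} (hQ : IsStarProjection Q) :
    opSqrt Q = Q :=
  CFC.sqrt_unique hQ.isIdempotentElem.eq
    ((ContinuousLinearMap.nonneg_iff_isPositive Q).2 (.of_isStarProjection hQ))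

end HilbertSchmidt

/-! ### Local Hilbert-Schmidt norms and the absorption argument -/

section RowMeasure

variable {X : Type*} [MeasurableSpace X] (μ : Measure X)
  {H : Type*} [NormedAddCommGroup H]

theorem lintegral_enorm_sq_Lp (f : Lp H 2 μ) : ∫⁻ x, ‖f x‖ₑ ^ 2 ∂μ = ‖f‖ₑ ^ 2 := by
  rw [Lp.enorm_def, eLpNorm_eq_lintegral_rpow_enorm_toReal (by simp) (by simp)]
  rw [ENNReal.toReal_ofNat, ← ENNReal.rpow_natCast, ← ENNReal.rpow_mul]
  norm_num

variable [InnerProductSpace ℂ H]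

theorem setLIntegral_enorm_sq_Lp {Ω : Set X} (hΩ : MeasurableSet Ω) (f : Lp H 2 μ) :
    ∫⁻ x in Ω, ‖f x‖ₑ ^ 2 ∂μ = ‖cutoff μ Ω hΩ f‖ₑ ^ 2 := by
  rw [← lintegral_enorm_sq_Lp, ← lintegral_indicator hΩ]
  refine lintegral_congr_ae ?_
  filter_upwards [coeFn_cutoff μ Ω hΩ f] with x hx
  rw [hx]
  by_cases h : x ∈ Ω <;> simp [h]

variable [CompleteSpace H]

/-- The measure `Ω ↦ ‖χ_Ω T‖²` with the Hilbert-Schmidt norm. -/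
def rowMeasure (T : Lp H 2 μ →L[ℂ] Lp H 2 μ) : Measure X :=
  Measure.sum fun i : (exists_hilbertBasis ℂ (Lp H 2 μ)).choose =>
    μ.withDensity fun x => ‖T (i : Lp H 2 μ) x‖ₑ ^ 2

theorem rowMeasure_apply (T : Lp H 2 μ →L[ℂ] Lp H 2 μ) {Ω : Set X} (hΩ : MeasurableSet Ω) :
    rowMeasure μ T Ω = formTrace fun v => ∫⁻ x in Ω, ‖T v x‖ₑ ^ 2 ∂μ := by
  rw [rowMeasure, Measure.sum_apply _ hΩ, formTrace]
  simp only [withDensity_apply _ hΩ]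

theorem rowMeasure_univ (T : Lp H 2 μ →L[ℂ] Lp H 2 μ) :
    rowMeasure μ T univ = formTrace fun v => ‖T v‖ₑ ^ 2 := by
  rw [rowMeasure_apply μ T MeasurableSet.univ]
  simp only [Measure.restrict_univ, lintegral_enorm_sq_Lp]

theorem rowMeasure_absolutelyContinuous (T : Lp H 2 μ →L[ℂ] Lp H 2 μ) : rowMeasure μ T ≪ μ :=
  Measure.absolutelyContinuous_sum_left fun _ => withDensity_absolutelyContinuous _ _

theorem traceMeasure_eq_rowMeasure (P : Lp H 2 μ →L[ℂ] Lp H 2 μ) :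
    traceMeasure μ P = rowMeasure μ (opSqrt P) := by
  ext Ω hΩ
  rw [traceMeasure, Measure.ofMeasurable_apply Ω hΩ, trace_sqrt_cutoff_sqrt,
    rowMeasure_apply μ _ hΩ]

theorem rowMeasure_comp_le (S T : Lp H 2 μ →L[ℂ] Lp H 2 μ) {Ω : Set X} (hΩ : MeasurableSet Ω) :
    rowMeasure μ (S ∘L T) Ω ≤ ‖T‖ₑ ^ 2 * rowMeasure μ S Ω := by
  have h := formTrace_comp_le (cutoff μ Ω hΩ ∘L S) T
  rw [rowMeasure_apply μ _ hΩ, rowMeasure_apply μ _ hΩ]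
  simp only [setLIntegral_enorm_sq_Lp μ hΩ]
  exact h

theorem enorm_add_sq_le {F : Type*} [NormedAddCommGroup F] (a b : F) :
    ‖a + b‖ₑ ^ 2 ≤ 2 * ‖a‖ₑ ^ 2 + 2 * ‖b‖ₑ ^ 2 := by
  have h : (‖a + b‖₊ : ℝ) ^ 2 ≤ 2 * (‖a‖₊ : ℝ) ^ 2 + 2 * (‖b‖₊ : ℝ) ^ 2 := by
    have h1 : (‖a + b‖₊ : ℝ) ≤ ‖a‖₊ + ‖b‖₊ := norm_add_le a b
    have h2 : (0 : ℝ) ≤ ‖a + b‖₊ := NNReal.coe_nonneg _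
    nlinarith [sq_nonneg ((‖a‖₊ : ℝ) - ‖b‖₊)]
  simp only [enorm_eq_nnnorm]
  exact_mod_cast h

theorem rowMeasure_add_le (S T : Lp H 2 μ →L[ℂ] Lp H 2 μ) {Ω : Set X} (hΩ : MeasurableSet Ω) :
    rowMeasure μ (S + T) Ω ≤ 2 * rowMeasure μ S Ω + 2 * rowMeasure μ T Ω := by
  rw [rowMeasure_apply μ _ hΩ, rowMeasure_apply μ _ hΩ, rowMeasure_apply μ _ hΩ,
    ← formTrace_const_mul, ← formTrace_const_mul, formTrace, formTrace, formTrace,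
    ← ENNReal.tsum_add]
  refine ENNReal.tsum_le_tsum fun i => ?_
  simp only [setLIntegral_enorm_sq_Lp μ hΩ, add_apply, map_add]
  exact enorm_add_sq_le _ _

theorem lintegral_density_eq [SigmaFinite μ] (P : Lp H 2 μ →L[ℂ] Lp H 2 μ) (Ω : Set X)
    (hΩ : MeasurableSet Ω) : ∫⁻ x in Ω, density μ P x ∂μ = rowMeasure μ (opSqrt P) Ω := by
  rw [← withDensity_apply _ hΩ, density, traceMeasure_eq_rowMeasure,
    withDensity_rnDeriv_of_absolutelyContinuous (rowMeasure_absolutelyContinuous μ _)]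

/-- The splitting of L = ρ^{1/2} holds on every measurable set, and ‖χ_Ω Q L‖² ≤ ‖L‖² ‖χ_Ω Q‖² with
‖L‖² = ‖ρ‖. As Q is its own square root, the last factor is ν_Q(Ω). -/
theorem ae_density_le [SigmaFinite μ] {ρ : Lp H 2 μ →L[ℂ] Lp H 2 μ} (hρ : ρ.IsPositive)
    {Q : Lp H 2 μ →L[ℂ] Lp H 2 μ} (hQ : IsStarProjection Q) :
    ∀ᵐ x ∂μ, density μ ρ x ≤ 2 * (ENNReal.ofReal ‖ρ‖ * density μ Q x) +
      2 * (rowMeasure μ (opSqrt ρ - Q ∘L opSqrt ρ)).rnDeriv μ x := by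
  have hm : ∀ P : Lp H 2 μ →L[ℂ] Lp H 2 μ, Measurable (density μ P) :=
    fun P => Measure.measurable_rnDeriv _ _
  have hm' : ∀ m : Measure X, Measurable (m.rnDeriv μ) := fun m => Measure.measurable_rnDeriv _ _
  refine ae_le_of_forall_setLIntegral_le_of_sigmaFinite (hm ρ) fun Ω hΩ _ => ?_
  have h1 := rowMeasure_add_le μ (Q ∘L opSqrt ρ) (opSqrt ρ - Q ∘L opSqrt ρ) hΩ
  have h2 := rowMeasure_comp_le μ Q (opSqrt ρ) hΩ
  have h3 : ‖opSqrt ρ‖ₑ ^ 2 = ENNReal.ofReal ‖ρ‖ := by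
    rw [← ofReal_norm, ← ENNReal.ofReal_pow (norm_nonneg _), norm_opSqrt_sq hρ]
  have hmQ := hm Q
  have hmr := hm' (rowMeasure μ (opSqrt ρ - Q ∘L opSqrt ρ))
  rw [add_sub_cancel] at h1
  rw [h3] at h2
  rw [lintegral_density_eq μ ρ Ω hΩ, lintegral_add_left (by fun_prop),
    lintegral_const_mul _ (by fun_prop), lintegral_const_mul _ (by fun_prop),
    lintegral_const_mul _ (by fun_prop), lintegral_density_eq μ Q Ω hΩ,
    opSqrt_of_isStarProjection hQ, ← withDensity_apply _ hΩ,
    withDensity_rnDeriv_of_absolutelyContinuous (rowMeasure_absolutelyContinuous μ _)]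
  exact h1.trans (by gcongr)

theorem traceMeasure_le_of_density_le [SigmaFinite μ] {ρ : Lp H 2 μ →L[ℂ] Lp H 2 μ}
    (hρ : ρ.IsPositive) (hρ_ne : ρ ≠ 0) {Q : Lp H 2 μ →L[ℂ] Lp H 2 μ} (hQ : IsStarProjection Q) :
    traceMeasure μ ρ {x | density μ Q x < ∞ ∧
        density μ Q x ≤ density μ ρ x / ENNReal.ofReal (4 * ‖ρ‖)} ≤
      4 * rowMeasure μ (opSqrt ρ - Q ∘L opSqrt ρ) univ := by
  have hm : ∀ P : Lp H 2 μ →L[ℂ] Lp H 2 μ, Measurable (density μ P) :=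
    fun P => Measure.measurable_rnDeriv _ _
  have hmρ := hm ρ
  have hmQ := hm Q
  set G := {x | density μ Q x < ∞ ∧
    density μ Q x ≤ density μ ρ x / ENNReal.ofReal (4 * ‖ρ‖)} with hG_def
  have hG : MeasurableSet G :=
    (measurableSet_lt hmQ measurable_const).inter (measurableSet_le hmQ (by fun_prop))
  have hr : 0 < ‖ρ‖ := norm_pos_iff.2 hρ_ne
  set D := (rowMeasure μ (opSqrt ρ - Q ∘L opSqrt ρ)).rnDeriv μ
  have key : ∀ᵐ x ∂μ, x ∈ G → density μ ρ x ≤ 4 * D x := by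
    filter_upwards [ae_density_le μ hρ hQ] with x hx hxG
    obtain ⟨h1, h2⟩ := hxG
    rw [ENNReal.le_div_iff_mul_le (Or.inl (ENNReal.ofReal_pos.2 (by positivity)).ne')
      (Or.inl ENNReal.ofReal_ne_top),
      ENNReal.ofReal_mul (by norm_num)] at h2
    by_cases hD : D x = ∞
    · simp [hD]
    -- Absorbing half of Dν_ρ requires it to be finite; this is where Dν_Q < ∞ on G enters.
    have hfin : density μ ρ x ≠ ∞ := by
      refine (hx.trans_lt ?_).ne
      exact ENNReal.add_lt_top.2 ⟨by finiteness, ENNReal.mul_lt_top (by simp) (lt_top_iff_ne_top.2 hD)⟩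
    change _ ≤ _ + 2 * D x at hx
    generalize D x = d at *
    generalize density μ ρ x = a at *
    generalize density μ Q x = q at *
    lift d to ℝ≥0 using hD
    lift a to ℝ≥0 using hfin
    lift q to ℝ≥0 using h1.ne
    rw [ENNReal.ofReal, ENNReal.ofReal] at h2
    rw [ENNReal.ofReal] at hx
    have h4 : (Real.toNNReal 4) = 4 := by norm_num
    rw [h4] at h2
    norm_cast at h2 hx ⊢
    rw [← NNReal.coe_le_coe] at h2 hx ⊢
    push_cast at h2 hx ⊢
    nlinarith
  calc traceMeasure μ ρ G = ∫⁻ x in G, density μ ρ x ∂μ := by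
        rw [lintegral_density_eq μ ρ G hG, traceMeasure_eq_rowMeasure]
    _ ≤ ∫⁻ x in G, 4 * D x ∂μ := setLIntegral_mono_ae (by fun_prop) key
    _ = 4 * rowMeasure μ (opSqrt ρ - Q ∘L opSqrt ρ) G := by
        rw [lintegral_const_mul _ (Measure.measurable_rnDeriv _ _), ← withDensity_apply _ hG,
          withDensity_rnDeriv_of_absolutelyContinuous (rowMeasure_absolutelyContinuous μ _)]
    _ ≤ _ := by
        gcongr
        exact subset_univ G

end RowMeasure

/-! ### Discrete layer cake formula -/

section LayerCake

/-- The grid points `(k + 1) / (n + 1)`. -/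
def gridPoint (n k : ℕ) : ℝ≥0 := ((k : ℝ≥0) + 1) / (n + 1)

/-- A Riemann sum of the length of `S`. -/
def gridSum (n : ℕ) (S : Set ℝ≥0) : ℝ≥0∞ :=
  ∑' k, (((n : ℝ≥0) + 1)⁻¹ : ℝ≥0) * S.indicator (1 : ℝ≥0 → ℝ≥0∞) (gridPoint n k)

/-- Right endpoints underestimate the length of an initial interval, so no error term appears on the
energy side. -/
theorem gridSum_Iio_le (n : ℕ) (t : ℝ≥0) : gridSum n (Iio t) ≤ t := by
  have h0 : (0 : ℝ≥0) < (n : ℝ≥0) + 1 := by positivity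
  rw [gridSum, tsum_eq_sum (s := Finset.range ⌊((n : ℝ≥0) + 1) * t⌋₊)]
  · calc _ ≤ ∑ k ∈ Finset.range ⌊((n : ℝ≥0) + 1) * t⌋₊, (((n : ℝ≥0) + 1)⁻¹ : ℝ≥0) * (1 : ℝ≥0∞) := by
          gcongr
          exact indicator_le_self' (fun _ _ => zero_le) _
      _ = (((⌊((n : ℝ≥0) + 1) * t⌋₊ : ℝ≥0) * ((n : ℝ≥0) + 1)⁻¹ : ℝ≥0) : ℝ≥0∞) := by
          rw [mul_one, Finset.sum_const, Finset.card_range, nsmul_eq_mul]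
          push_cast
          rfl
      _ ≤ t := by
          rw [ENNReal.coe_le_coe, ← div_eq_mul_inv, div_le_iff₀ h0, mul_comm t]
          exact Nat.floor_le zero_le
  · intro k hk
    rw [Finset.mem_range, not_lt] at hk
    rw [indicator_of_notMem, mul_zero]
    rw [mem_Iio, not_lt, gridPoint, le_div_iff₀ h0, mul_comm t]
    have h1 := Nat.lt_floor_add_one (((n : ℝ≥0) + 1) * t)
    have h2 : (⌊((n : ℝ≥0) + 1) * t⌋₊ : ℝ≥0) ≤ k := by exact_mod_cast hk
    exact h1.le.trans (by gcongr)

/-- At most one cell of width 1 / (n + 1) is lost. -/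
theorem sub_le_gridSum (n : ℕ) {S : Set ℝ≥0} {t : ℝ≥0} (hS : ∀ s ≤ t, s ∈ S) :
    (t : ℝ≥0∞) - (((n : ℝ≥0) + 1)⁻¹ : ℝ≥0) ≤ gridSum n S := by
  have h0 : (0 : ℝ≥0) < (n : ℝ≥0) + 1 := by positivity
  rw [tsub_le_iff_right, gridSum]
  refine le_trans ?_ (add_le_add_left (ENNReal.sum_le_tsum
    (Finset.range ⌊((n : ℝ≥0) + 1) * t⌋₊)) _)
  have h1 : ∀ k ∈ Finset.range ⌊((n : ℝ≥0) + 1) * t⌋₊,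
      (((n : ℝ≥0) + 1)⁻¹ : ℝ≥0) * S.indicator (1 : ℝ≥0 → ℝ≥0∞) (gridPoint n k) =
        (((n : ℝ≥0) + 1)⁻¹ : ℝ≥0) := fun k hk => by
    rw [indicator_of_mem, Pi.one_apply, mul_one]
    refine hS _ ?_
    rw [gridPoint, div_le_iff₀ h0, mul_comm t]
    have h2 : ((k + 1 : ℕ) : ℝ≥0) ≤ ⌊((n : ℝ≥0) + 1) * t⌋₊ := by
      exact_mod_cast Finset.mem_range.1 hk
    push_cast at h2
    exact h2.trans (Nat.floor_le zero_le)
  rw [Finset.sum_congr rfl h1, Finset.sum_const, Finset.card_range, nsmul_eq_mul]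
  have h3 : t ≤ ⌊((n : ℝ≥0) + 1) * t⌋₊ * ((n : ℝ≥0) + 1)⁻¹ + ((n : ℝ≥0) + 1)⁻¹ := by
    rw [← add_one_mul, ← div_eq_mul_inv, le_div_iff₀ h0, mul_comm t]
    exact (Nat.lt_floor_add_one _).le
  exact_mod_cast h3

theorem genInverse_le_liminf_gridSum {f : ℝ≥0 → ℝ≥0∞} (hf : Monotone f) (u : ℝ≥0∞) :
    genInverse f u ≤ liminf (fun n => gridSum n {t | f t < ∞ ∧ f t ≤ u}) atTop := by
  refine iSup₂_le fun t ht => ?_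
  have h1 : Tendsto (fun n : ℕ => (t : ℝ≥0∞) - (((n : ℝ≥0) + 1)⁻¹ : ℝ≥0)) atTop
      (𝓝 ((t : ℝ≥0∞) - (0 : ℝ≥0))) := by
    refine ENNReal.Tendsto.sub tendsto_const_nhds (ENNReal.tendsto_coe.2 ?_)
      (Or.inl ENNReal.coe_ne_top)
    have := tendsto_one_div_add_atTop_nhds_zero_nat (𝕜 := ℝ≥0)
    simpa using this
  rw [ENNReal.coe_zero, tsub_zero] at h1
  rw [← h1.liminf_eq]
  exact liminf_le_liminf (Eventually.of_forall fun n => sub_le_gridSum n fun s hs =>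
    ⟨(hf hs).trans_lt ht.1, (hf hs).trans ht.2⟩)

/-- After exchanging sum and integral, the integrand at t is the grid sum of [0, t). -/
theorem tsum_measure_Ioi_gridPoint_le (m : Measure ℝ) (n : ℕ) :
    ∑' k, (((n : ℝ≥0) + 1)⁻¹ : ℝ≥0) * m (Ioi (gridPoint n k : ℝ)) ≤
      ∫⁻ t, ENNReal.ofReal t ∂m := by
  have h : ∀ k, (((n : ℝ≥0) + 1)⁻¹ : ℝ≥0) * m (Ioi (gridPoint n k : ℝ)) =
      ∫⁻ t, (((n : ℝ≥0) + 1)⁻¹ : ℝ≥0) * (Ioi (gridPoint n k : ℝ)).indicator 1 t ∂m := fun k => by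
    rw [lintegral_const_mul _ (measurable_one.indicator measurableSet_Ioi),
      lintegral_indicator_one measurableSet_Ioi]
  simp only [h]
  rw [← lintegral_tsum fun k =>
    ((measurable_one.indicator measurableSet_Ioi).const_mul _).aemeasurable]
  refine lintegral_mono fun t => (le_of_eq ?_).trans (gridSum_Iio_le n t.toNNReal)
  refine tsum_congr fun k => ?_
  congr 1
  by_cases ht : (gridPoint n k : ℝ) < t
  · rw [indicator_of_mem (mem_Ioi.2 ht),
      indicator_of_mem (mem_Iio.2 (Real.lt_toNNReal_iff_coe_lt.2 ht))]
    rfl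
  · rw [indicator_of_notMem (mt mem_Ioi.1 ht),
      indicator_of_notMem (mt (fun h => Real.lt_toNNReal_iff_coe_lt.1 (mem_Iio.1 h)) ht)]

end LayerCake

/-! ### The kernel of A -/

section Kernel

variable {E : Type*} [NormedAddCommGroup E] [InnerProductSpace ℂ E] [CompleteSpace E]
  {A : E →ₗ.[ℂ] E} {ρ : E →L[ℂ] E}

/-- The vector w lies in ker A, so ‖L w‖² = ⟨w, ρ w⟩ = 0, and then ‖w‖² = ⟨w, L v⟩ = ⟨L w, v⟩ = 0.
-/
theorem spectralProjection_zero_opSqrt (hA : IsSelfAdjoint A)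
    (hA_pos : ∀ v : A.domain, 0 ≤ (⟪(v : E), A v⟫_ℂ).re) (hρ : ρ.IsPositive)
    (hker : ∀ v : A.domain, A v = 0 → ρ v = 0) (v : E) :
    spectralProjection A {0} (opSqrt ρ v) = 0 := by
  have hsp := (spectralMeasure A).isStarProjection {0} (measurableSet_singleton 0)
  set L := opSqrt ρ with hL
  set w := spectralProjection A {0} (L v) with hw
  have h1 : ρ w = 0 := by
    obtain ⟨h, h'⟩ := (isSpectralMeasure_spectralMeasure hA hA_pos).apply_proj_singleton_zero
      hA hA_pos (L v)
    exact hker ⟨_, h⟩ h'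
  have h2 : L (L w) = ρ w := by
    have h := CFC.sqrt_mul_sqrt_self ρ ((ContinuousLinearMap.nonneg_iff_isPositive ρ).2 hρ)
    exact congrArg (fun T : E →L[ℂ] E => T w) h
  have h3 : L w = 0 := by
    rw [← inner_self_eq_zero (𝕜 := ℂ), ← inner_opSqrt_right, ← hL, h2, h1, inner_zero_right]
  have h4 : ⟪w, w⟫_ℂ = ⟪w, L v⟫_ℂ := by
    have h5 : spectralProjection A {0} w = w := by
      have h := hsp.isIdempotentElem.eq
      exact congrArg (fun T : E →L[ℂ] E => T (L v)) h
    conv_lhs => rw [hw]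
    rw [← ContinuousLinearMap.adjoint_inner_left, spectralProjection, hsp.isSelfAdjoint.adjoint_eq]
    exact congrArg (fun z => ⟪z, L v⟫_ℂ) h5
  rw [← inner_self_eq_zero (𝕜 := ℂ), h4, inner_opSqrt_right, ← hL, h3, inner_zero_left]

end Kernel

/-! ### The inequality -/

section Main

variable {X : Type*} [MeasurableSpace X] {μ : Measure X} [SigmaFinite μ]
  {H : Type*} [NormedAddCommGroup H] [InnerProductSpace ℂ H] [CompleteSpace H]
  {A : Lp H 2 μ →ₗ.[ℂ] Lp H 2 μ} {ρ : Lp H 2 μ →L[ℂ] Lp H 2 μ}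

theorem lintegral_genInverse_le (hρ : ρ.IsPositive) (hρ_ne : ρ ≠ 0)
    {Q : ℝ≥0 → (Lp H 2 μ →L[ℂ] Lp H 2 μ)} (hQ : ∀ t, IsStarProjection (Q t))
    (hQ_sub : ∀ t v, opSqrt ρ v - Q t (opSqrt ρ v) =
      spectralProjection A (Ioi (t : ℝ)) (opSqrt ρ v))
    {F : X → ℝ≥0 → ℝ≥0∞} (hF : IsPointwiseDensity μ Q F) :
    ∫⁻ x, genInverse (F x) (density μ ρ x / ENNReal.ofReal (4 * ‖ρ‖)) ∂(traceMeasure μ ρ) ≤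
      4 * energy A ρ := by
  have hac : traceMeasure μ ρ ≪ μ := by
    rw [traceMeasure_eq_rowMeasure]
    exact rowMeasure_absolutelyContinuous μ _
  have hm : ∀ P : Lp H 2 μ →L[ℂ] Lp H 2 μ, Measurable (density μ P) :=
    fun P => Measure.measurable_rnDeriv _ _
  -- Defined through the densities rather than through F, these sets are measurable.
  let G : ℝ≥0 → Set X := fun t => {x | density μ (Q t) x < ∞ ∧
    density μ (Q t) x ≤ density μ ρ x / ENNReal.ofReal (4 * ‖ρ‖)}
  have hG : ∀ t, MeasurableSet (G t) := fun t =>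
    (measurableSet_lt (hm _) measurable_const).inter
      (measurableSet_le (hm _) ((hm ρ).div_const _))
  let g : ℕ → X → ℝ≥0∞ := fun n x => gridSum n {t | x ∈ G t}
  have hg_eq : ∀ n, g n = fun x => ∑' k, ((((n : ℝ≥0) + 1)⁻¹ : ℝ≥0) : ℝ≥0∞) *
      (G (gridPoint n k)).indicator 1 x := fun n => rfl
  have hg_meas : ∀ n k : ℕ, Measurable fun x => ((((n : ℝ≥0) + 1)⁻¹ : ℝ≥0) : ℝ≥0∞) *
      (G (gridPoint n k)).indicator 1 x := fun n k =>
    (measurable_one.indicator (hG _)).const_mul _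
  have hg : ∀ n, Measurable (g n) := fun n => by
    rw [hg_eq]
    exact Measurable.tsum (hg_meas n)
  have h1 : ∀ᵐ x ∂(traceMeasure μ ρ),
      genInverse (F x) (density μ ρ x / ENNReal.ofReal (4 * ‖ρ‖)) ≤
        liminf (fun n => g n x) atTop := by
    refine hac.ae_le ?_
    -- Only countably many grid points occur, so one null set suffices.
    have h2 : ∀ᵐ x ∂μ, ∀ n k, F x (gridPoint n k) = density μ (Q (gridPoint n k)) x :=
      ae_all_iff.2 fun n => ae_all_iff.2 fun k => hF.2 _
    filter_upwards [hF.1, h2] with x hx1 hx2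
    refine (genInverse_le_liminf_gridSum hx1 _).trans_eq ?_
    congr 1
    funext n
    refine tsum_congr fun k => ?_
    congr 1
    simp only [indicator, mem_ofPred_eq, hx2, G]
    split_ifs <;> rfl
  have h3 : ∀ n, ∫⁻ x, g n x ∂(traceMeasure μ ρ) ≤ 4 * energy A ρ := fun n => by
    rw [hg_eq, lintegral_tsum fun k => (hg_meas n k).aemeasurable]
    calc _ = ∑' k, (((n : ℝ≥0) + 1)⁻¹ : ℝ≥0) * traceMeasure μ ρ (G (gridPoint n k)) := by
          refine tsum_congr fun k => ?_
          rw [lintegral_const_mul _ (measurable_one.indicator (hG _)),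
            lintegral_indicator_one (hG _)]
      _ ≤ ∑' k, (((n : ℝ≥0) + 1)⁻¹ : ℝ≥0) * (4 * formTrace fun v =>
            (spectralMeasure A).scalar (opSqrt ρ v) (Ioi (gridPoint n k : ℝ))) := by
          refine ENNReal.tsum_le_tsum fun k => ?_
          gcongr
          refine (traceMeasure_le_of_density_le μ hρ hρ_ne (hQ _)).trans_eq ?_
          rw [rowMeasure_univ]
          congr 2
          funext v
          rw [ProjectionValuedMeasure.scalar_apply _ _ measurableSet_Ioi, ← enorm_sq_eq_ofReal]
          exact congrArg (fun w => ‖w‖ₑ ^ 2) (hQ_sub _ v)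
      _ = 4 * formTrace fun v => ∑' k, (((n : ℝ≥0) + 1)⁻¹ : ℝ≥0) *
            (spectralMeasure A).scalar (opSqrt ρ v) (Ioi (gridPoint n k : ℝ)) := by
          simp only [formTrace]
          rw [ENNReal.tsum_comm, ← ENNReal.tsum_mul_left]
          refine tsum_congr fun k => ?_
          rw [ENNReal.tsum_mul_left, mul_left_comm]
      _ ≤ 4 * energy A ρ := by
          gcongr
          exact formTrace_mono fun v => tsum_measure_Ioi_gridPoint_le _ n
  calc _ ≤ ∫⁻ x, liminf (fun n => g n x) atTop ∂(traceMeasure μ ρ) := lintegral_mono_ae h1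
    _ ≤ liminf (fun n => ∫⁻ x, g n x ∂(traceMeasure μ ρ)) atTop := lintegral_liminf_le hg
    _ ≤ liminf (fun _ : ℕ => 4 * energy A ρ) atTop :=
        liminf_le_liminf (Eventually.of_forall h3)
    _ = 4 * energy A ρ := liminf_const _

end Main

end MixedState

end

theorem mainTheorem3 {X : Type*} [MeasurableSpace X] (μ : Measure X) [SigmaFinite μ]
    {H : Type*} [NormedAddCommGroup H] [InnerProductSpace ℂ H] [CompleteSpace H]
    (A : Lp H 2 μ →ₗ.[ℂ] Lp H 2 μ) (hA : IsSelfAdjoint A)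
    (hA_pos : ∀ v : A.domain, 0 ≤ (⟪(v : Lp H 2 μ), A v⟫_ℂ).re)
    (ρ : Lp H 2 μ →L[ℂ] Lp H 2 μ) (hρ : ρ.IsPositive) (hρ_ne : ρ ≠ 0)
    (F : X → ℝ≥0 → ℝ≥0∞)
    (hF : ((∀ v : A.domain, A v = 0 → ρ v = 0) ∧
        MixedState.IsPointwiseDensity μ
          (fun t => MixedState.spectralProjection A (Ioc 0 (t : ℝ))) F) ∨
      MixedState.IsPointwiseDensity μ
        (fun t => MixedState.spectralProjection A (Icc 0 (t : ℝ))) F) :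
    ∫⁻ x, MixedState.genInverse (F x)
        (MixedState.density μ ρ x / ENNReal.ofReal (4 * ‖ρ‖)) ∂(MixedState.traceMeasure μ ρ) ≤
      4 * MixedState.energy A ρ := by
  rcases hF with ⟨hker, hF⟩ | hF
  · refine MixedState.lintegral_genInverse_le hρ hρ_ne
      (fun t => (MixedState.spectralMeasure A).isStarProjection _ measurableSet_Ioc)
      (fun t v => ?_) hF
    have h := MixedState.sub_spectralProjection_Icc hA hA_pos (NNReal.coe_nonneg t)
      (MixedState.opSqrt ρ v)
    -- On the range of ρ^{1/2} the projections for [0, t] and ]0, t] agree.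
    rw [MixedState.spectralProjection_Icc_eq_Ioc (NNReal.coe_nonneg t)
      (MixedState.spectralProjection_zero_opSqrt hA hA_pos hρ hker v)] at h
    exact h
  · exact MixedState.lintegral_genInverse_le hρ hρ_ne
      (fun t => (MixedState.spectralMeasure A).isStarProjection _ measurableSet_Icc)
      (fun t v => MixedState.sub_spectralProjection_Icc hA hA_pos (NNReal.coe_nonneg t) _) hF
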